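/- A multigraph here is finite, undirected and loopless, and parallel edges are allowed. A randomized single-pass streaming algorithm for $n$-vertex multigraphs using $s$ bits of space sees the edges one at a time; after each edge its $s$-bit memory is updated as a function of its old content, the arriving edge, the index of the edge in the stream and the internal randomness of the algorithm, and at the end of the stream it produces an answer from its memory, the length of the stream and its internal randomness. The edges are presented in uniformly random order, and all probabilities are over this order and the independent internal randomness. $\mathrm{OPT}(G)$ denotes the maximum, over all bipartitions of the vertex set, of the number of edges of $G$ (with multiplicity) that cross the bipartition. A multigraph is $\beta$-far from bipartite if each of its bipartite subgraphs contains at most a $(1-\beta)$-fraction of its edges. (1) For every constant $0<\varepsilon<2$ there are $c>0$, $b,N\in\mathbb N$ and $K$, depending only on $\varepsilon$, such that for all $n\ge N$: every randomized single-pass streaming algorithm that on each $n$-vertex multigraph $G$ with at most $Kn$ edges outputs, with probability at least $99/100$, a value in $[\mathrm{OPT}(G)/(2-\varepsilon),\,\mathrm{OPT}(G)]$, uses at least $c\sqrt n/(\log n)^b$ bits of space. In particular, $(2-\varepsilon)$-approximating the max-cut value of $n$-vertex multigraphs with probability at least $99/100$ requires $\widetilde\Omega(\sqrt n)$ space. (2)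 For every constant $0<\varepsilon<1/2$ there are $c>0$, $b,N\in\mathbb N$ and $K$, depending only on $\varepsilon$, such that for all $n\ge N$: every randomized single-pass streaming algorithm that on each $n$-vertex multigraph $G$ with at least one and at most $Kn$ edges answers, with probability at least $99/100$, "bipartite" if $G$ is bipartite, and "far" if $G$ is $(\tfrac12-\varepsilon)$-far from bipartite, uses at least $c\sqrt n/(\log n)^b$ bits of space. -/

import Mathlib

open MeasureTheory

universe u

/-- A finite loopless undirected multigraph on the vertex set `Fin n`: it has `m` edges, labelled by
`Fin m`, each of which is an unordered pair of distinct vertices; parallel edges are allowed. -/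
structure MultiG (n : ℕ) where
  m : ℕ
  edge : Fin m → Sym2 (Fin n)
  loopless : ∀ i, ¬ (edge i).IsDiag

/-- The edge `e` has one endpoint in `S` and the other one outside `S`. -/
def Crosses {n : ℕ} (S : Finset (Fin n)) (e : Sym2 (Fin n)) : Prop :=
  ∃ u v : Fin n, u ∈ S ∧ v ∉ S ∧ e = s(u, v)

namespace MultiG

variable {n : ℕ}

open Classical in
/-- The number of edges (with multiplicity) crossing the bipartition `(S, Sᶜ)`. -/
noncomputable def cutSize (G : MultiG n) (S : Finset (Fin n)) : ℕ :=
  (Finset.univ.filter fun i : Fin G.m => Crosses S (G.edge i)).card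

/-- The max-cut value: the maximum of `cutSize` over all bipartitions of the vertex set. -/
noncomputable def maxCut (G : MultiG n) : ℕ :=
  (Finset.univ : Finset (Finset (Fin n))).sup G.cutSize

/-- The subgraph of `G` with edge set `A` is bipartite. -/
def BipartiteOn (G : MultiG n) (A : Finset (Fin G.m)) : Prop :=
  ∃ S : Finset (Fin n), ∀ i ∈ A, Crosses S (G.edge i)

def IsBipartite (G : MultiG n) : Prop := G.BipartiteOn Finset.univ

/-- `G` is `β`-far from bipartite: every bipartite subgraph contains at most a `1 - β` fraction of
the edges. -/
def IsFar (G : MultiG n) (β : ℝ) : Prop :=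
  ∀ A : Finset (Fin G.m), G.BipartiteOn A → (A.card : ℝ) ≤ (1 - β) * G.m

end MultiG

/-- A randomized single-pass streaming algorithm for streams of edges on `n` vertices, with `s` bits
of memory and answers in `α`. Its internal randomness is a seed `ω : Ω`, which the algorithm can
read at any time; when the edge number `t` arrives, the new memory content is a function of the
seed, of `t`, of the old memory content and of the edge. The answer is read off at the end of the
stream. No computability or uniformity in `n` is required, and neither the seed nor the clock `t`
counts towards the `s` bits. -/
structure StreamAlg (n s : ℕ) (α : Type*) [MeasurableSpace α] (Ω : Type*) [MeasurableSpace Ω] where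
  init : Ω → (Fin s → Bool)
  step : Ω → ℕ → (Fin s → Bool) → Sym2 (Fin n) → (Fin s → Bool)
  answer : Ω → ℕ → (Fin s → Bool) → α
  measurable_init : Measurable init
  measurable_step : ∀ t x e, Measurable fun ω => step ω t x e
  measurable_answer : ∀ t x, Measurable fun ω => answer ω t x

namespace StreamAlg

variable {n s : ℕ} {α : Type*} [MeasurableSpace α] {Ω : Type*} [MeasurableSpace Ω]

/-- The answer on the stream `x 0, x 1, …, x (m - 1)` with the seed `ω`. -/
def run (A : StreamAlg n s α Ω) (ω : Ω) {m : ℕ} (x : Fin m → Sym2 (Fin n)) : α :=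
  A.answer ω m (Fin.foldl m (fun mem i => A.step ω i mem (x i)) (A.init ω))

/-- The probability, over a uniformly random order of the edges of `G` and an independent seed with
law `P`, that the answer lies in `T`. -/
noncomputable def prob (A : StreamAlg n s α Ω) (P : Measure Ω) (G : MultiG n) (T : Set α) : ℝ :=
  (∑ σ : Equiv.Perm (Fin G.m), P.real {ω | A.run ω (fun i => G.edge (σ i)) ∈ T}) /
    (Fintype.card (Equiv.Perm (Fin G.m)) : ℝ)

/-- On every multigraph with at most `M` edges in random order, the answer is in
`[OPT / γ, OPT]` with probability at least `99/100`. -/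
def ApproximatesMaxCut (A : StreamAlg n s ℝ Ω) (P : Measure Ω) (γ M : ℝ) : Prop :=
  ∀ G : MultiG n, (G.m : ℝ) ≤ M →
    99 / 100 ≤ A.prob P G (Set.Icc ((G.maxCut : ℝ) / γ) (G.maxCut : ℝ))

/-- On every multigraph with at least one and at most `M` edges in random order, the answer is,
with probability at least `99/100`, `true` if the multigraph is bipartite and `false` if it is
`β`-far from bipartite. -/
def DistinguishesBipartite (A : StreamAlg n s Bool Ω) (P : Measure Ω) (β M : ℝ) : Prop :=
  ∀ G : MultiG n, 0 < G.m → (G.m : ℝ) ≤ M →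
    (G.IsBipartite → 99 / 100 ≤ A.prob P G {true}) ∧
    (G.IsFar β → 99 / 100 ≤ A.prob P G {false})

end StreamAlg

/-!
The lower bound comes from two distributions on streams of `m = Θ(n)` edges that a small memory
cannot tell apart. The uniform one consists of independent uniformly random edges; by a Chernoff
bound over all `2 ^ n` cuts, its multigraph has no cut with much more than half of the edges
(`expect_maxCut_gt_le`). The other one hides a uniformly random `x : Fin k → Bool`, `k = n / 2`,
which colours the vertices `(i, a)` by `a * x i`, and consists of independent random edges that
cross this colouring, so that its multigraph is bipartite. Both distributions are exchangeable,
hence the random order of the edges makes no difference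
(`StreamAlg.expect_mul_prob_labelGraph`), and by averaging over the seed one may consider
deterministic algorithms.

The stream is cut into a constant number of chunks of `α * k` edges, for a small constant `α`.
Suppose that before a chunk the memory content leaves a posterior density `g ≤ M` of `x`. The
second moment of the likelihood ratio of the chunk against uniform edges is at most
`exp (-α) * 𝔼 x, 𝔼 y, g x * g y * exp (α * Z ^ 2 / k)`, where `Z = ∑ i, x i * y i` is the overlap of
two samples. Writing the exponential of the square as a Gaussian average of exponentials
`exp (θ * Z)` turns this into noise stabilities of `g`, and these are at most `M ^ O(θ)` by
hypercontractivity (`noise_stability_le`). If `log M`, which is about the number of bits of memory,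
is small compared to `√k`, then the second moment is `1 + O(α ^ 2)` (`chunk_second_moment`).

The first-order term in `α` has cancelled, and the divergences of the chunks add up to `O(α)` by a
chain rule for the memory contents (`expect_sum_memLaw_le`). The chain rule is stated in its dual
form: a test function for the final memory content is pulled back along the stream by
`f ↦ log 𝔼 exp f` under the uniform distribution, and one step is the Donsker–Varadhan inequality.
Adding up total variation distances, each bounded by the square root of the `O(α ^ 2)` above, would
not do, since there are `Θ(1 / α)` chunks.

The argument yields the bound with exponent `0` for the logarithm.
-/

open scoped BigOperators

/-! ### Hypercontractivity on the discrete cube -/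

/-- The sign `±1` encoded by a Boolean. -/
def sgn (b : Bool) : ℝ := if b then 1 else -1

@[simp] lemma sgn_true : sgn true = 1 := if_pos rfl

@[simp] lemma sgn_false : sgn false = -1 := if_neg Bool.false_ne_true

lemma sgn_mul_self (b : Bool) : sgn b * sgn b = 1 := by cases b <;> simp [sgn]

lemma sgn_eq_or (b : Bool) : sgn b = 1 ∨ sgn b = -1 := by cases b <;> simp [sgn]

lemma expect_bool (f : Bool → ℝ) : 𝔼 b, f b = (f true + f false) / 2 := by
  rw [Fintype.expect_eq_sum_div_card]
  simp

lemma expect_cons {k : ℕ} (F : (Fin (k + 1) → Bool) → ℝ) :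
    𝔼 x, F x = 𝔼 b, 𝔼 x : Fin k → Bool, F (Fin.cons b x) := by
  rw [← Finset.expect_product', Finset.univ_product_univ]
  exact (Fintype.expect_equiv (Fin.consEquiv fun _ => Bool) _ _ fun _ => rfl).symm

lemma expect_cons₂ {k : ℕ} (F : (Fin (k + 1) → Bool) → (Fin (k + 1) → Bool) → ℝ) :
    𝔼 x, 𝔼 y, F x y = 𝔼 b, 𝔼 c, 𝔼 x : Fin k → Bool, 𝔼 y : Fin k → Bool,
      F (Fin.cons b x) (Fin.cons c y) := by
  rw [expect_cons]
  refine Finset.expect_congr rfl fun b _ => ?_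
  exact (Finset.expect_congr rfl fun x _ => expect_cons (F (Fin.cons b x))).trans
    (Finset.expect_comm _ _ _)

/-- A weak two-point inequality, near `p = 1`: the `p`-th moment of `1 ± b` grows quadratically
in `b`. -/
lemma two_point_moment {u v q : ℝ} (hu : 0 ≤ u) (hv : 0 ≤ v) (huv : u + v = 2) (hq : 0 ≤ q) :
    1 + q * ((u - v) / 2) ^ 2 / 4 ≤ (u ^ (1 + q) + v ^ (1 + q)) / 2 := by
  -- `log w = 2 * log √w ≥ 2 * (1 - 1 / √w)`, which is polynomial in `√w` after multiplication by `w`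
  have key : ∀ w : ℝ, 0 ≤ w → w + 2 * q * (w - √w) ≤ w ^ (1 + q) := by
    intro w hw
    rcases hw.eq_or_lt with rfl | hw
    · simpa using Real.rpow_nonneg le_rfl _
    · have hs : 0 < √w := Real.sqrt_pos.2 hw
      have hlog : 2 * (1 - (√w)⁻¹) ≤ Real.log w := by
        have h1 := Real.one_sub_inv_le_log_of_pos hs
        rw [Real.log_sqrt hw.le] at h1
        linarith
      have h2 : 1 + q * (2 * (1 - (√w)⁻¹)) ≤ w ^ q := by
        rw [Real.rpow_def_of_pos hw]
        have h3 := Real.add_one_le_exp (Real.log w * q)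
        nlinarith
      have h4 : w * (√w)⁻¹ = √w := by
        rw [← div_eq_mul_inv, Real.div_sqrt]
      rw [Real.rpow_add hw, Real.rpow_one]
      nlinarith [mul_le_mul_of_nonneg_left h2 hw.le]
  have h1 := key u hu
  have h2 := key v hv
  have ha := Real.sqrt_nonneg u
  have hc := Real.sqrt_nonneg v
  have ha2 := Real.sq_sqrt hu
  have hc2 := Real.sq_sqrt hv
  set a := √u
  set c := √v
  have h3 : ((u - v) / 2) ^ 2 / 4 ≤ 2 - (a + c) := by
    have ht : a + c ≤ 2 := by nlinarith [sq_nonneg (a - c)]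
    have e : ((u - v) / 2) ^ 2 / 4 = (a + c) ^ 2 * (4 - (a + c) ^ 2) / 16 := by
      have : (a - c) ^ 2 = 4 - (a + c) ^ 2 := by nlinarith
      rw [← this, ← ha2, ← hc2]; ring
    rw [e]
    have h5 : (a + c) ^ 2 * (2 + (a + c)) ≤ 16 := by
      have : (a + c) ^ 2 ≤ 4 := by nlinarith
      nlinarith
    nlinarith [mul_nonneg (sub_nonneg.2 ht) (sub_nonneg.2 h5)]
  nlinarith [mul_le_mul_of_nonneg_left h3 hq]

/-- For every noise rate `r` there is an exponent `p`, with `1 - 1 / p = O(r)`, for which the noise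
operator on one bit contracts `L ^ p` into `L ^ 2`. -/
lemma exists_two_point_exponent {r : ℝ} (hr0 : 0 ≤ r) (hr1 : r ≤ 1) :
    ∃ p : ℝ, 1 ≤ p ∧ 1 - 1 / p ≤ 2 * r ∧ ∀ u v : ℝ, 0 ≤ u → 0 ≤ v →
      ((u + v) / 2) ^ 2 + r * ((u - v) / 2) ^ 2 ≤ (((u ^ p + v ^ p) / 2) ^ (1 / p)) ^ 2 := by
  rcases le_or_gt r (1 / 4) with hr | hr
  · have hd : 0 < 1 - 2 * r := by linarith
    refine ⟨1 / (1 - 2 * r), ?_, by simp, ?_⟩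
    · rw [le_div_iff₀ hd]; linarith
    intro u v hu hv
    set p := 1 / (1 - 2 * r) with hp
    have hp1 : 1 ≤ p := by rw [hp, le_div_iff₀ hd]; linarith
    have hp2 : p ≤ 2 := by rw [hp, div_le_iff₀ hd]; linarith
    have hpr : p - 1 = 2 * r * p := by rw [hp]; field_simp; ring
    have hp0 : 0 < p := by linarith
    rcases (show 0 ≤ (u + v) / 2 by positivity).eq_or_lt with h0 | h0
    · have hu0 : u = 0 := by linarith
      have hv0 : v = 0 := by linarith
      subst hu0; subst hv0
      simp only [add_zero, sub_zero, zero_div, ne_eq, OfNat.ofNat_ne_zero, not_false_eq_true,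
        zero_pow, mul_zero]
      positivity
    · set f := (u + v) / 2 with hf
      have h1 := two_point_moment (u := u / f) (v := v / f) (q := p - 1) (by positivity)
        (by positivity) (by rw [← add_div, div_eq_iff h0.ne']; linarith) (by linarith)
      rw [add_sub_cancel, Real.div_rpow hu h0.le, Real.div_rpow hv h0.le] at h1
      set b := (u - v) / 2 with hb
      have hb' : (u / f - v / f) / 2 = b / f := by rw [hb]; ring
      rw [hb'] at h1
      set R := (u ^ p + v ^ p) / 2 with hR
      have hfp : 0 < f ^ p := Real.rpow_pos_of_pos h0 p
      have h1' : 1 + (p - 1) * (b / f) ^ 2 / 4 ≤ R / f ^ p := by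
        refine h1.trans (le_of_eq ?_); rw [hR]; ring
      have hnn : 0 ≤ (p - 1) * (b / f) ^ 2 / 4 := by
        have : 0 ≤ p - 1 := by linarith
        positivity
      have h2 := one_add_mul_self_le_rpow_one_add (s := (p - 1) * (b / f) ^ 2 / 4) (by linarith)
        (p := 2 / p) (by rw [le_div_iff₀ hp0]; linarith)
      have h3 : (1 + (p - 1) * (b / f) ^ 2 / 4) ^ (2 / p) ≤ (R / f ^ p) ^ (2 / p) :=
        Real.rpow_le_rpow (by linarith) h1' (by positivity)
      have hR0 : 0 ≤ R := by positivity
      have h4 : (R / f ^ p) ^ (2 / p) = (R ^ (1 / p)) ^ 2 / f ^ 2 := by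
        rw [Real.div_rpow hR0 hfp.le, ← Real.rpow_mul h0.le, ← Real.rpow_natCast (R ^ (1 / p)),
          ← Real.rpow_mul hR0]
        congr 1
        · congr 1; push_cast; ring
        · rw [mul_div_cancel₀ _ hp0.ne']; norm_num
      have h5 : 2 / p * ((p - 1) * (b / f) ^ 2 / 4) = r * b ^ 2 / f ^ 2 := by
        rw [hpr]; field_simp; ring
      rw [h5] at h2
      have h6 := h2.trans (h3.trans_eq h4)
      have hf2 : 0 < f ^ 2 := by positivity
      rw [le_div_iff₀ hf2] at h6
      have h7 : (1 + r * b ^ 2 / f ^ 2) * f ^ 2 = f ^ 2 + r * b ^ 2 := by field_simp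
      linarith
  · refine ⟨2, by norm_num, by linarith, ?_⟩
    intro u v hu hv
    have h : 0 ≤ (u ^ (2 : ℝ) + v ^ (2 : ℝ)) / 2 := by positivity
    rw [← Real.sqrt_eq_rpow, Real.sq_sqrt h, Real.rpow_two, Real.rpow_two]
    nlinarith [sq_nonneg (u - v)]

lemma bilinear_le {a b c d ρ A B : ℝ} (hA : 0 ≤ A) (hB : 0 ≤ B)
    (h1 : a ^ 2 + |ρ| * b ^ 2 ≤ A ^ 2) (h2 : c ^ 2 + |ρ| * d ^ 2 ≤ B ^ 2) :
    a * c + ρ * (b * d) ≤ A * B := by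
  refine (le_abs_self _).trans (abs_le_of_sq_le_sq ?_ (mul_nonneg hA hB))
  rw [mul_pow]
  refine le_trans ?_ (mul_le_mul h1 h2 (by positivity) (by positivity))
  have e : (a ^ 2 + |ρ| * b ^ 2) * (c ^ 2 + |ρ| * d ^ 2) - (a * c + ρ * (b * d)) ^ 2 =
      |ρ| * ((a * d) ^ 2 + (b * c) ^ 2) - 2 * (ρ * (a * d) * (b * c))
        + (|ρ| ^ 2 - ρ ^ 2) * (b * d) ^ 2 := by ring
  rw [sq_abs, sub_self, zero_mul, add_zero] at e
  have hm : 2 * (ρ * (a * d) * (b * c)) ≤ |ρ| * ((a * d) ^ 2 + (b * c) ^ 2) := by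
    rcases abs_cases ρ with ⟨h, h0⟩ | ⟨h, h0⟩ <;> rw [h]
    · nlinarith [mul_nonneg h0 (sq_nonneg (a * d - b * c))]
    · nlinarith [mul_nonneg (neg_nonneg.2 h0.le) (sq_nonneg (a * d + b * c))]
  linarith

/-- The two-function form of hypercontractivity. In this form it tensorizes by a plain induction on
the dimension. -/
theorem hypercontractive {ρ p : ℝ} (hρ : |ρ| ≤ 1) (hp : 1 ≤ p)
    (h2 : ∀ u v : ℝ, 0 ≤ u → 0 ≤ v →
      ((u + v) / 2) ^ 2 + |ρ| * ((u - v) / 2) ^ 2 ≤ (((u ^ p + v ^ p) / 2) ^ (1 / p)) ^ 2)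
    {k : ℕ} (f g : (Fin k → Bool) → ℝ) (hf : ∀ x, 0 ≤ f x) (hg : ∀ x, 0 ≤ g x) :
    𝔼 x, 𝔼 y, f x * g y * ∏ i, (1 + ρ * (sgn (x i) * sgn (y i))) ≤
      (𝔼 x, f x ^ p) ^ (1 / p) * (𝔼 x, g x ^ p) ^ (1 / p) := by
  have hp0 : 0 < p := by linarith
  induction k with
  | zero =>
    simp only [Finset.univ_unique, Finset.expect_singleton, Finset.univ_eq_empty,
      Finset.prod_empty, mul_one]
    rw [← Real.rpow_mul (hf _), ← Real.rpow_mul (hg _), mul_one_div_cancel hp0.ne',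
      Real.rpow_one, Real.rpow_one]
  | succ k ih =>
    set N : ((Fin (k + 1) → Bool) → ℝ) → Bool → ℝ :=
      fun f b => (𝔼 x : Fin k → Bool, f (Fin.cons b x) ^ p) ^ (1 / p) with hN
    have hN0 : ∀ f : (Fin (k + 1) → Bool) → ℝ, (∀ x, 0 ≤ f x) → ∀ b, 0 ≤ N f b := fun f hf b =>
      Real.rpow_nonneg (Finset.expect_nonneg fun x _ => Real.rpow_nonneg (hf _) _) _
    have hNp : ∀ f : (Fin (k + 1) → Bool) → ℝ, (∀ x, 0 ≤ f x) →
        𝔼 x, f x ^ p = (N f true ^ p + N f false ^ p) / 2 := by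
      intro f hf
      have : ∀ b, N f b ^ p = 𝔼 x : Fin k → Bool, f (Fin.cons b x) ^ p := by
        intro b
        rw [hN]
        simp only
        rw [← Real.rpow_mul (Finset.expect_nonneg fun x _ => Real.rpow_nonneg (hf _) _),
          one_div_mul_cancel hp0.ne', Real.rpow_one]
      rw [expect_cons, expect_bool, this, this]
    have hker : ∀ b c, 0 ≤ 1 + ρ * (sgn b * sgn c) := by
      obtain ⟨h, h'⟩ := abs_le.1 hρ
      intro b c
      cases b <;> cases c <;> simp [sgn] <;> linarith
    have step : ∀ b c, 𝔼 x : Fin k → Bool, 𝔼 y : Fin k → Bool,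
        f (Fin.cons b x) * g (Fin.cons c y) *
          ∏ i, (1 + ρ * (sgn ((Fin.cons b x : Fin (k + 1) → Bool) i) *
            sgn ((Fin.cons c y : Fin (k + 1) → Bool) i))) ≤
        (1 + ρ * (sgn b * sgn c)) * (N f b * N g c) := by
      intro b c
      refine le_trans (le_of_eq ?_) (mul_le_mul_of_nonneg_left
        (ih (fun x => f (Fin.cons b x)) (fun x => g (Fin.cons c x)) (fun _ => hf _)
          (fun _ => hg _)) (hker b c))
      simp only [Finset.mul_expect, Fin.prod_univ_succ, Fin.cons_zero, Fin.cons_succ]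
      refine Finset.expect_congr rfl fun x _ => Finset.expect_congr rfl fun y _ => ?_
      ring
    have lhs : 𝔼 x, 𝔼 y, f x * g y * ∏ i, (1 + ρ * (sgn (x i) * sgn (y i))) =
        𝔼 b, 𝔼 c, 𝔼 x : Fin k → Bool, 𝔼 y : Fin k → Bool,
          f (Fin.cons b x) * g (Fin.cons c y) *
          ∏ i, (1 + ρ * (sgn ((Fin.cons b x : Fin (k + 1) → Bool) i) *
            sgn ((Fin.cons c y : Fin (k + 1) → Bool) i))) := by
      exact expect_cons₂ fun x y => f x * g y * ∏ i, (1 + ρ * (sgn (x i) * sgn (y i)))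
    rw [lhs, hNp f hf, hNp g hg]
    refine (Finset.expect_le_expect fun b _ => Finset.expect_le_expect fun c _ => step b c).trans ?_
    have hu := hN0 f hf true
    have hv := hN0 f hf false
    have hw := hN0 g hg true
    have hz := hN0 g hg false
    have q1 := h2 _ _ hu hv
    have q2 := h2 _ _ hw hz
    have hA : 0 ≤ ((N f true ^ p + N f false ^ p) / 2) ^ (1 / p) := by positivity
    have hB : 0 ≤ ((N g true ^ p + N g false ^ p) / 2) ^ (1 / p) := by positivity
    simp only [expect_bool, sgn]
    have e := bilinear_le (ρ := ρ) hA hB q1 q2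
    refine le_trans (le_of_eq ?_) e
    norm_num
    ring

/-- The noise stability of a probability density bounded by `M` is at most `M ^ O(ρ)`. -/
theorem noise_stability_le {k : ℕ} {ρ M : ℝ} (hρ : |ρ| ≤ 1) (g : (Fin k → Bool) → ℝ)
    (hg : ∀ x, 0 ≤ g x) (hgM : ∀ x, g x ≤ M) (hg1 : 𝔼 x, g x = 1) :
    𝔼 x, 𝔼 y, g x * g y * ∏ i, (1 + ρ * (sgn (x i) * sgn (y i))) ≤
      Real.exp (4 * |ρ| * Real.log M) := by
  obtain ⟨p, hp1, hp2, hp⟩ := exists_two_point_exponent (abs_nonneg ρ) hρ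
  have hp0 : 0 < p := by linarith
  have hM1 : 1 ≤ M := by
    rw [← hg1]
    exact (Finset.expect_le_expect fun x _ => hgM x).trans_eq (Fintype.expect_const M)
  have hM0 : 0 < M := by linarith
  refine (hypercontractive hρ hp1 hp g g hg hg).trans ?_
  have h1 : 𝔼 x, g x ^ p ≤ M ^ (p - 1) := by
    calc 𝔼 x, g x ^ p ≤ 𝔼 x, M ^ (p - 1) * g x := by
          refine Finset.expect_le_expect fun x _ => ?_
          rcases (hg x).eq_or_lt with h | h
          · rw [← h, Real.zero_rpow hp0.ne', mul_zero]
          · calc g x ^ p = g x ^ (p - 1) * g x := by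
                  rw [Real.rpow_sub_one h.ne', div_mul_cancel₀ _ h.ne']
              _ ≤ _ := by
                  exact mul_le_mul_of_nonneg_right
                    (Real.rpow_le_rpow (hg x) (hgM x) (by linarith)) (hg x)
      _ = M ^ (p - 1) := by rw [← Finset.mul_expect, hg1, mul_one]
  have h0 : 0 ≤ 𝔼 x, g x ^ p := Finset.expect_nonneg fun x _ => Real.rpow_nonneg (hg x) _
  have h2 : (𝔼 x, g x ^ p) ^ (1 / p) ≤ M ^ (1 - 1 / p) := by
    refine (Real.rpow_le_rpow h0 h1 (by positivity)).trans_eq ?_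
    rw [← Real.rpow_mul hM0.le]
    congr 1
    field_simp
  refine (mul_le_mul h2 h2 (by positivity) (by positivity)).trans ?_
  rw [← Real.rpow_add hM0, Real.rpow_def_of_pos hM0, Real.exp_le_exp]
  have := Real.log_nonneg hM1
  nlinarith

/-! ### Exponential moments of the overlap of two hidden colourings -/

lemma abs_tanh_le (θ : ℝ) : |Real.tanh θ| ≤ 2 * |θ| := by
  have key : ∀ t : ℝ, 0 ≤ t → Real.tanh t ≤ 2 * t := by
    intro t ht
    rw [Real.tanh_eq_sinh_div_cosh, div_le_iff₀ (Real.cosh_pos t), Real.sinh_eq, Real.cosh_eq]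
    have h1 := Real.add_one_le_exp (-(2 * t))
    have h2 : Real.exp (-t) = Real.exp t * Real.exp (-(2 * t)) := by
      rw [← Real.exp_add]; congr 1; ring
    have h3 := Real.exp_pos t
    have h4 := Real.exp_pos (-t)
    nlinarith [mul_le_mul_of_nonneg_left h1 h3.le, mul_nonneg ht h4.le]
  rcases le_total 0 θ with h | h
  · rw [abs_of_nonneg h, abs_of_nonneg]
    · exact key θ h
    · rw [Real.tanh_eq_sinh_div_cosh]
      exact div_nonneg (Real.sinh_nonneg_iff.2 h) (Real.cosh_pos _).le
  · rw [abs_of_nonpos h, abs_of_nonpos]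
    · rw [← Real.tanh_neg]; exact key (-θ) (by linarith)
    · rw [Real.tanh_eq_sinh_div_cosh]
      exact div_nonpos_of_nonpos_of_nonneg (Real.sinh_nonpos_iff.2 h) (Real.cosh_pos _).le

/-- The overlap `∑ i, x i * y i` of two colourings. -/
def overlap {k : ℕ} (x y : Fin k → Bool) : ℝ := ∑ i, sgn (x i) * sgn (y i)

/-- The moment generating function of the overlap of two independent samples from a bounded
density: since the summands are signs, `exp (θ * z) = cosh θ * (1 + tanh θ * z)` turns it into a
noise stability. -/
theorem mgf_overlap_le {k : ℕ} {M : ℝ} (θ : ℝ) (g : (Fin k → Bool) → ℝ)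
    (hg : ∀ x, 0 ≤ g x) (hgM : ∀ x, g x ≤ M) (hg1 : 𝔼 x, g x = 1) :
    𝔼 x, 𝔼 y, g x * g y * Real.exp (θ * overlap x y) ≤
      Real.exp (k * θ ^ 2 / 2 + 8 * |θ| * Real.log M) := by
  have hM1 : 1 ≤ M := by
    rw [← hg1]
    exact (Finset.expect_le_expect fun x _ => hgM x).trans_eq (Fintype.expect_const M)
  have e : ∀ x y : Fin k → Bool, Real.exp (θ * overlap x y) =
      Real.cosh θ ^ k * ∏ i, (1 + Real.tanh θ * (sgn (x i) * sgn (y i))) := by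
    intro x y
    have h1 : ∀ b c : Bool, Real.exp (θ * (sgn b * sgn c)) =
        Real.cosh θ * (1 + Real.tanh θ * (sgn b * sgn c)) := by
      intro b c
      have hc := (Real.cosh_pos θ).ne'
      have hz : sgn b * sgn c = 1 ∨ sgn b * sgn c = -1 := by
        cases b <;> cases c <;> simp [sgn]
      rw [Real.tanh_eq_sinh_div_cosh]
      rcases hz with h | h <;> rw [h]
      · field_simp; rw [← Real.cosh_add_sinh]
      · field_simp; rw [← Real.cosh_add_sinh (-θ), Real.cosh_neg, Real.sinh_neg]
    rw [overlap, Finset.mul_sum, Real.exp_sum]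
    simp_rw [h1]
    rw [Finset.prod_mul_distrib]
    simp
  have hT : |Real.tanh θ| ≤ 1 := (Real.abs_tanh_lt_one θ).le
  calc 𝔼 x, 𝔼 y, g x * g y * Real.exp (θ * overlap x y)
      = Real.cosh θ ^ k * 𝔼 x, 𝔼 y, g x * g y *
          ∏ i, (1 + Real.tanh θ * (sgn (x i) * sgn (y i))) := by
        simp only [Finset.mul_expect, e]
        refine Finset.expect_congr rfl fun x _ => Finset.expect_congr rfl fun y _ => ?_
        ring
    _ ≤ Real.exp (θ ^ 2 / 2) ^ k * Real.exp (4 * |Real.tanh θ| * Real.log M) := by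
        refine mul_le_mul (pow_le_pow_left₀ (Real.cosh_pos θ).le (Real.cosh_le_exp_half_sq θ) k)
          (noise_stability_le hT g hg hgM hg1) ?_ (by positivity)
        refine Finset.expect_nonneg fun x _ => Finset.expect_nonneg fun y _ =>
          mul_nonneg (mul_nonneg (hg x) (hg y)) (Finset.prod_nonneg fun i _ => ?_)
        obtain ⟨h, h'⟩ := abs_le.1 hT
        rcases sgn_eq_or (x i) with h1 | h1 <;> rcases sgn_eq_or (y i) with h2 | h2 <;>
          rw [h1, h2] <;> linarith
    _ ≤ _ := by
        rw [← Real.exp_nat_mul, ← Real.exp_add, Real.exp_le_exp]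
        have h1 := mul_le_mul_of_nonneg_right (abs_tanh_le θ) (Real.log_nonneg hM1)
        have h2 : (k : ℝ) * (θ ^ 2 / 2) = k * θ ^ 2 / 2 := by ring
        linarith

lemma gaussian_shift_eq (c h : ℝ) : Real.exp (-h ^ 2 / 2 + c * h) =
    Real.exp (c ^ 2 / 2) * Real.exp (-(1 / 2) * (h - c) ^ 2) := by
  rw [← Real.exp_add]; congr 1; ring

lemma integrable_gaussian_shift (c : ℝ) :
    Integrable fun h : ℝ => Real.exp (-h ^ 2 / 2 + c * h) := by
  simp_rw [gaussian_shift_eq]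
  exact ((integrable_exp_neg_mul_sq (b := 1 / 2) (by norm_num)).comp_sub_right c).const_mul _

lemma integral_gaussian_shift (c : ℝ) :
    ∫ h : ℝ, Real.exp (-h ^ 2 / 2 + c * h) = √(2 * Real.pi) * Real.exp (c ^ 2 / 2) := by
  simp_rw [gaussian_shift_eq]
  rw [integral_const_mul, integral_sub_right_eq_self (fun h : ℝ => Real.exp (-(1 / 2) * h ^ 2)) c,
    integral_gaussian, mul_comm]
  congr 2
  ring

/-- Gaussian linearization: a sub-Gaussian moment generating function bounds the exponential moment
of the square. -/
theorem exp_sq_le_of_mgf_le {I : Type*} [Fintype I] (w Z : I → ℝ) {a b : ℝ} (hb : 0 ≤ b)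
    (hab : 2 * a + b < 1)
    (H : ∀ θ, 𝔼 i, w i * Real.exp (θ * Z i) ≤ Real.exp (a * θ ^ 2 + b * |θ|)) :
    𝔼 i, w i * Real.exp (Z i ^ 2 / 2) ≤ Real.exp (b / 2) * √(1 / (1 - 2 * a - b)) := by
  have hpi : 0 < √(2 * Real.pi) := by positivity
  have hd : 0 < 1 / 2 - a - b / 2 := by linarith
  refine le_of_mul_le_mul_left ?_ hpi
  have h1 : √(2 * Real.pi) * 𝔼 i, w i * Real.exp (Z i ^ 2 / 2) =
      ∫ h : ℝ, 𝔼 i, w i * Real.exp (-h ^ 2 / 2 + Z i * h) := by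
    simp only [Fintype.expect_eq_sum_div_card]
    rw [integral_div, integral_finsetSum _ fun i _ => (integrable_gaussian_shift _).const_mul _,
      mul_div_assoc', Finset.mul_sum]
    congr 1
    refine Finset.sum_congr rfl fun i _ => ?_
    rw [integral_const_mul, integral_gaussian_shift]
    ring
  have h2 : Integrable fun h : ℝ => 𝔼 i, w i * Real.exp (-h ^ 2 / 2 + Z i * h) := by
    simp only [Fintype.expect_eq_sum_div_card]
    exact (integrable_finsetSum _ fun i _ => (integrable_gaussian_shift _).const_mul _).div_const _
  have h3 : Integrable fun h : ℝ =>
      Real.exp (b / 2) * Real.exp (-(1 / 2 - a - b / 2) * h ^ 2) :=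
    (integrable_exp_neg_mul_sq hd).const_mul _
  have h4 : ∫ h : ℝ, Real.exp (b / 2) * Real.exp (-(1 / 2 - a - b / 2) * h ^ 2) =
      √(2 * Real.pi) * (Real.exp (b / 2) * √(1 / (1 - 2 * a - b))) := by
    rw [integral_const_mul, integral_gaussian, mul_left_comm, ← Real.sqrt_mul (by positivity)]
    congr 2
    have : 1 - 2 * a - b ≠ 0 := by linarith
    field_simp
  rw [h1, ← h4]
  refine integral_mono h2 h3 fun h => ?_
  calc 𝔼 i, w i * Real.exp (-h ^ 2 / 2 + Z i * h)
      = Real.exp (-h ^ 2 / 2) * 𝔼 i, w i * Real.exp (h * Z i) := by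
        rw [Finset.mul_expect]
        refine Finset.expect_congr rfl fun i _ => ?_
        rw [Real.exp_add, mul_comm h]; ring
    _ ≤ Real.exp (-h ^ 2 / 2) * Real.exp (a * h ^ 2 + b * |h|) := by
        gcongr
        exact H h
    _ ≤ _ := by
        rw [← Real.exp_add, ← Real.exp_add, Real.exp_le_exp]
        have : |h| ≤ (1 + h ^ 2) / 2 := by
          have := sq_nonneg (|h| - 1)
          rw [← sq_abs h]; nlinarith
        nlinarith [mul_le_mul_of_nonneg_left this hb]

lemma sqrt_inv_le_exp {γ : ℝ} (h0 : 0 ≤ γ) (h1 : γ ≤ 1 / 4) :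
    √(1 / (1 - 2 * γ)) ≤ Real.exp (γ + 2 * γ ^ 2) := by
  rw [Real.sqrt_le_left (Real.exp_pos _).le, ← Real.exp_nat_mul, div_le_iff₀ (by linarith)]
  have h := Real.quadratic_le_exp_of_nonneg (x := 2 * γ + 4 * γ ^ 2) (by positivity)
  have e : ((2 : ℕ) : ℝ) * (γ + 2 * γ ^ 2) = 2 * γ + 4 * γ ^ 2 := by push_cast; ring
  rw [e]
  refine le_trans ?_ (mul_le_mul_of_nonneg_right h (by linarith))
  have h2 : 0 ≤ γ ^ 2 * ((1 - 2 * γ) * (1 + 2 * γ) ^ 2 - 4 * γ) := by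
    refine mul_nonneg (sq_nonneg _) ?_
    nlinarith [mul_nonneg h0 h0, mul_nonneg h0 (sub_nonneg.2 h1), mul_nonneg (mul_nonneg h0 h0)
      (sub_nonneg.2 h1)]
  nlinarith

/-! ### Random edges with a hidden colouring -/

/-- Labels of edges on the `2 * k` vertices `(i, a)`, `i : Fin k` and `a : Bool`: the label
`(i, j, a, b)` stands for the edge between `(i, a)` and `(j, b)` if `i ≠ j`, and for the edge
between `(i, true)` and `(i, false)` if `i = j`. -/
abbrev Label (k : ℕ) : Type := Fin k × Fin k × Bool × Bool

/-- The density, relative to the uniform distribution on labels, of a random edge compatible with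
the hidden colouring in which the vertex `(i, a)` has the colour `sgn a * sgn (x i)`. Both
colours are used equally often whatever `x` is, so that no normalization is needed. -/
def dens {k : ℕ} (x : Fin k → Bool) (e : Label k) : ℝ :=
  if e.1 = e.2.1 then 1
  else 1 - sgn e.2.2.1 * sgn e.2.2.2 * (sgn (x e.1) * sgn (x e.2.1))

lemma dens_nonneg {k : ℕ} (x : Fin k → Bool) (e : Label k) : 0 ≤ dens x e := by
  unfold dens
  split_ifs
  · exact zero_le_one
  · rcases sgn_eq_or e.2.2.1 with h1 | h1 <;> rcases sgn_eq_or e.2.2.2 with h2 | h2 <;>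
      rcases sgn_eq_or (x e.1) with h3 | h3 <;> rcases sgn_eq_or (x e.2.1) with h4 | h4 <;>
      rw [h1, h2, h3, h4] <;> norm_num

lemma expect_label {k : ℕ} (F : Label k → ℝ) :
    𝔼 e, F e = 𝔼 i, 𝔼 j, 𝔼 a, 𝔼 b, F (i, j, a, b) := by
  rw [← Finset.univ_product_univ, Finset.expect_product]
  refine Finset.expect_congr rfl fun i _ => ?_
  rw [← Finset.univ_product_univ, Finset.expect_product]
  refine Finset.expect_congr rfl fun j _ => ?_
  rw [← Finset.univ_product_univ, Finset.expect_product]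

lemma expect_dens {k : ℕ} (hk : 0 < k) (x : Fin k → Bool) : 𝔼 e, dens x e = 1 := by
  have : Nonempty (Fin k) := ⟨⟨0, hk⟩⟩
  rw [expect_label]
  have : ∀ i j, 𝔼 a, 𝔼 b, dens x (i, j, a, b) = 1 := by
    intro i j
    simp only [expect_bool, dens]
    split_ifs
    · norm_num
    · simp only [sgn_true, sgn_false]
      ring
  simp only [this, Fintype.expect_const]

lemma expect_dens_mul_dens {k : ℕ} (hk : 0 < k) (x y : Fin k → Bool) :
    𝔼 e, dens x e * dens y e = 1 + (overlap x y ^ 2 - k) / (k : ℝ) ^ 2 := by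
  have : Nonempty (Fin k) := ⟨⟨0, hk⟩⟩
  have hk' : (k : ℝ) ≠ 0 := by positivity
  set z : Fin k → ℝ := fun i => sgn (x i) * sgn (y i) with hz
  have hzz : ∀ i, z i * z i = 1 := by
    intro i
    have := sgn_mul_self (x i)
    have := sgn_mul_self (y i)
    simp only [hz]
    nlinarith
  have h : ∀ i j, 𝔼 a, 𝔼 b, dens x (i, j, a, b) * dens y (i, j, a, b) =
      1 + z i * z j - if i = j then 1 else 0 := by
    intro i j
    simp only [expect_bool, dens]
    split_ifs with hij
    · subst hij; rw [hzz]; norm_num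
    · simp only [sgn_true, sgn_false, hz]
      ring
  rw [expect_label]
  simp only [h, Finset.expect_sub_distrib, Finset.expect_add_distrib, Fintype.expect_const]
  have h1 : 𝔼 i, 𝔼 j, z i * z j = overlap x y ^ 2 / (k : ℝ) ^ 2 := by
    rw [← Fintype.expect_mul_expect, Fintype.expect_eq_sum_div_card, Fintype.card_fin, overlap]
    simp only [hz]
    field_simp
  rw [h1]
  have h2 : 𝔼 i : Fin k, 𝔼 j : Fin k, (if i = j then (1 : ℝ) else 0) = 1 / k := by
    simp only [Fintype.expect_eq_sum_div_card, Finset.sum_ite_eq, Finset.mem_univ, if_true,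
      Fintype.card_fin, Finset.sum_const, Finset.card_univ, nsmul_eq_mul]
    field_simp
  rw [h2]
  field_simp
  ring

/-- The density of a sequence of independent edges compatible with the hidden colouring `x`. -/
def chunkDens {k m : ℕ} (x : Fin k → Bool) (e : Fin m → Label k) : ℝ := ∏ i, dens x (e i)

lemma chunkDens_nonneg {k m : ℕ} (x : Fin k → Bool) (e : Fin m → Label k) : 0 ≤ chunkDens x e :=
  Finset.prod_nonneg fun _ _ => dens_nonneg _ _

lemma expect_pi_prod {I : Type*} [Fintype I] (m : ℕ) (f : I → ℝ) :
    𝔼 e : Fin m → I, ∏ i, f (e i) = (𝔼 i, f i) ^ m := by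
  rw [Finset.expect_pow, Fintype.piFinset_univ]

lemma expect_chunkDens {k : ℕ} (hk : 0 < k) (m : ℕ) (x : Fin k → Bool) :
    𝔼 e : Fin m → Label k, chunkDens x e = 1 := by
  simp only [chunkDens]
  rw [expect_pi_prod, expect_dens hk, one_pow]

/-- The second moment bound for a chunk of `m ≤ a * k` edges: if the hidden colouring has a
density `g` bounded by `M`, then the likelihood ratio of the chunk against uniformly random edges
has second moment `1 + O(a ^ 2)`, provided that `log M` is small compared to `√k`. -/
theorem chunk_second_moment {k m : ℕ} (hk : 0 < k) {a M : ℝ} (hma : (m : ℝ) / k ≤ a)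
    (ha : a ≤ 1 / 16) (hM : 4 * √(2 * a / k) * Real.log M ≤ a ^ 2) (g : (Fin k → Bool) → ℝ)
    (hg : ∀ x, 0 ≤ g x) (hgM : ∀ x, g x ≤ M) (hg1 : 𝔼 x, g x = 1) :
    𝔼 e : Fin m → Label k, (𝔼 x, g x * chunkDens x e) ^ 2 ≤ Real.exp (10 * a ^ 2) := by
  have hM1 : 1 ≤ M := by
    rw [← hg1]
    exact (Finset.expect_le_expect fun x _ => hgM x).trans_eq (Fintype.expect_const M)
  have hk' : (0 : ℝ) < k := by exact_mod_cast hk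
  set α : ℝ := m / k with hα
  have hα0 : 0 ≤ α := by positivity
  have hL : 0 ≤ Real.log M := Real.log_nonneg hM1
  set β : ℝ := √(2 * α / k) with hβ
  have hβ2 : β ^ 2 = 2 * α / k := Real.sq_sqrt (by positivity)
  have hβ0 : 0 ≤ β := Real.sqrt_nonneg _
  set κ : ℝ := 4 * β * Real.log M with hκ
  have hκ0 : 0 ≤ κ := by positivity
  have hκa : κ ≤ a ^ 2 := by
    refine le_trans ?_ hM
    rw [hκ, hβ]
    gcongr
  have hγ : α + κ ≤ 2 * a := by nlinarith
  have swap : 𝔼 e : Fin m → Label k, (𝔼 x, g x * chunkDens x e) ^ 2 =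
      𝔼 x, 𝔼 y, g x * g y * (1 + (overlap x y ^ 2 - k) / (k : ℝ) ^ 2) ^ m := by
    simp_rw [sq (𝔼 x, g x * chunkDens x _), Fintype.expect_mul_expect]
    rw [Finset.expect_comm]
    refine Finset.expect_congr rfl fun x _ => ?_
    rw [Finset.expect_comm]
    refine Finset.expect_congr rfl fun y _ => ?_
    rw [← expect_dens_mul_dens hk, ← expect_pi_prod, Finset.mul_expect]
    refine Finset.expect_congr rfl fun e _ => ?_
    rw [Finset.prod_mul_distrib, chunkDens, chunkDens]
    ring
  have hpow : ∀ x y : Fin k → Bool, (1 + (overlap x y ^ 2 - k) / (k : ℝ) ^ 2) ^ m ≤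
      Real.exp (-α) * Real.exp ((β * overlap x y) ^ 2 / 2) := by
    intro x y
    have h0 : 0 ≤ 1 + (overlap x y ^ 2 - k) / (k : ℝ) ^ 2 := by
      rw [← expect_dens_mul_dens hk]
      exact Finset.expect_nonneg fun e _ => mul_nonneg (dens_nonneg _ _) (dens_nonneg _ _)
    calc _ ≤ Real.exp ((overlap x y ^ 2 - k) / (k : ℝ) ^ 2) ^ m := by
          refine pow_le_pow_left₀ h0 ?_ m
          rw [add_comm]; exact Real.add_one_le_exp _
      _ = _ := by
          rw [← Real.exp_nat_mul, ← Real.exp_add, mul_pow, hβ2, hα]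
          congr 1
          field_simp
          ring
  have hmain := exp_sq_le_of_mgf_le
    (fun p : (Fin k → Bool) × (Fin k → Bool) => g p.1 * g p.2)
    (fun p => β * overlap p.1 p.2) (a := α) (b := 2 * κ) (by positivity) (by linarith) (by
      intro θ
      rw [← Finset.univ_product_univ, Finset.expect_product]
      have := mgf_overlap_le (θ * β) g hg hgM hg1
      simp only [mul_assoc] at this ⊢
      refine this.trans (le_of_eq ?_)
      congr 1
      rw [mul_pow, hβ2, abs_mul, abs_of_nonneg hβ0, hκ]
      field_simp
      ring)
  rw [← Finset.univ_product_univ, Finset.expect_product] at hmain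
  rw [swap]
  calc 𝔼 x, 𝔼 y, g x * g y * (1 + (overlap x y ^ 2 - k) / (k : ℝ) ^ 2) ^ m
      ≤ 𝔼 x, 𝔼 y, Real.exp (-α) * (g x * g y * Real.exp ((β * overlap x y) ^ 2 / 2)) := by
        refine Finset.expect_le_expect fun x _ => Finset.expect_le_expect fun y _ => ?_
        have := mul_le_mul_of_nonneg_left (hpow x y) (mul_nonneg (hg x) (hg y))
        linarith
    _ = Real.exp (-α) * 𝔼 x, 𝔼 y, (g x * g y * Real.exp ((β * overlap x y) ^ 2 / 2)) := by
        simp only [Finset.mul_expect]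
    _ ≤ Real.exp (-α) * (Real.exp (2 * κ / 2) * √(1 / (1 - 2 * α - 2 * κ))) := by
        gcongr
    _ ≤ Real.exp (-α) * (Real.exp κ * Real.exp ((α + κ) + 2 * (α + κ) ^ 2)) := by
        have := sqrt_inv_le_exp (γ := α + κ) (by positivity) (by linarith)
        rw [mul_div_cancel_left₀ κ two_ne_zero, show 1 - 2 * α - 2 * κ = 1 - 2 * (α + κ) by ring]
        gcongr
    _ ≤ _ := by
        rw [← Real.exp_add, ← Real.exp_add, Real.exp_le_exp]
        nlinarith

/-! ### Divergence of the memory contents along a stream -/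

/-- The Donsker–Varadhan bound, with the relative entropy replaced by the (larger) chi-squared
divergence. -/
lemma expect_mul_le_log_expect_exp {E : Type*} [Fintype E] [Nonempty E] (l F : E → ℝ) {η : ℝ}
    (hl : ∀ e, 0 ≤ l e) (hl1 : 𝔼 e, l e = 1) (hl2 : 𝔼 e, l e ^ 2 ≤ 1 + η) :
    𝔼 e, l e * F e ≤ Real.log (𝔼 e, Real.exp (F e)) + η := by
  set c := Real.log (𝔼 e, Real.exp (F e)) with hc
  have hpos : 0 < 𝔼 e, Real.exp (F e) :=
    Finset.expect_pos (fun e _ => Real.exp_pos _) Finset.univ_nonempty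
  have hF : 𝔼 e, Real.exp (F e - c) = 1 := by
    simp_rw [Real.exp_sub]
    rw [← Finset.expect_div, hc, Real.exp_log hpos, div_self hpos.ne']
  have key : ∀ e, l e * F e ≤ c * l e + (l e ^ 2 - 2 * l e + Real.exp (F e - c)) := by
    intro e
    rcases (hl e).eq_or_lt with h | h
    · rw [← h]; simpa using (Real.exp_pos _).le
    · have h1 := Real.add_one_le_exp (F e - c - Real.log (l e))
      have h2 := Real.log_le_sub_one_of_pos h
      have h3 : Real.exp (F e - c) = l e * Real.exp (F e - c - Real.log (l e)) := by
        rw [Real.exp_sub (F e - c), Real.exp_log h, mul_div_cancel₀ _ h.ne']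
      rw [h3]
      nlinarith [mul_le_mul_of_nonneg_left h1 h.le, mul_le_mul_of_nonneg_left h2 h.le]
  refine (Finset.expect_le_expect fun e _ => key e).trans ?_
  rw [Finset.expect_add_distrib, Finset.expect_add_distrib, Finset.expect_sub_distrib, hF,
    ← Finset.mul_expect, ← Finset.mul_expect, hl1]
  linarith

section Streams

variable {X E S : Type*} [Fintype E] [Fintype S] [DecidableEq S]

lemma expect_snoc (t : ℕ) (F : (Fin (t + 1) → E) → ℝ) :
    𝔼 e, F e = 𝔼 e : Fin t → E, 𝔼 y : E, F (Fin.snoc e y) := by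
  rw [Finset.expect_comm, ← Finset.expect_product', Finset.univ_product_univ]
  exact (Fintype.expect_equiv (Fin.snocEquiv fun _ => E) _ _ fun _ => rfl).symm

/-- The law of the memory content after `t` independent arrivals of density `D x`, for the
transition functions `step` and the initial content `s₀`. -/
noncomputable def memLaw (D : X → E → ℝ) (step : ℕ → S → E → S) (s₀ : S) : ℕ → X → S → ℝ
  | 0, _, s => if s = s₀ then 1 else 0
  | t + 1, x, s => ∑ r, memLaw D step s₀ t x r * 𝔼 e, D x e * if step t r e = s then 1 else 0

variable (D : X → E → ℝ) (step : ℕ → S → E → S) (s₀ : S)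

lemma sum_memLaw_succ (t : ℕ) (x : X) (f : S → ℝ) :
    ∑ s, memLaw D step s₀ (t + 1) x s * f s =
      ∑ r, memLaw D step s₀ t x r * 𝔼 e, D x e * f (step t r e) := by
  simp only [memLaw, Finset.sum_mul]
  rw [Finset.sum_comm]
  refine Finset.sum_congr rfl fun r _ => ?_
  simp only [mul_assoc]
  rw [← Finset.mul_sum]
  congr 1
  simp only [Finset.expect_mul]
  rw [← Finset.expect_sum_comm]
  refine Finset.expect_congr rfl fun e _ => ?_
  simp

lemma memLaw_nonneg (hD : ∀ x e, 0 ≤ D x e) (t : ℕ) (x : X) (s : S) :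
    0 ≤ memLaw D step s₀ t x s := by
  induction t generalizing s with
  | zero => simp only [memLaw]; split_ifs <;> norm_num
  | succ t ih =>
    refine Finset.sum_nonneg fun r _ => mul_nonneg (ih r) (Finset.expect_nonneg fun e _ => ?_)
    exact mul_nonneg (hD x e) (by split_ifs <;> norm_num)

lemma sum_memLaw (hD1 : ∀ x, 𝔼 e, D x e = 1) (t : ℕ) (x : X) :
    ∑ s, memLaw D step s₀ t x s = 1 := by
  induction t with
  | zero => simp [memLaw]
  | succ t ih =>
    have := sum_memLaw_succ D step s₀ t x fun _ => 1
    simpa [hD1, ih] using this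

lemma expect_foldl (t : ℕ) (x : X) (f : S → ℝ) :
    𝔼 e : Fin t → E, (∏ i, D x (e i)) * f (Fin.foldl t (fun s i => step i s (e i)) s₀) =
      ∑ s, memLaw D step s₀ t x s * f s := by
  induction t generalizing f with
  | zero => simp [memLaw]
  | succ t ih =>
    rw [sum_memLaw_succ, ← ih, expect_snoc]
    refine Finset.expect_congr rfl fun e _ => ?_
    rw [Finset.mul_expect]
    refine Finset.expect_congr rfl fun y _ => ?_
    rw [Fin.prod_univ_castSucc, Fin.foldl_succ_last]
    simp only [Fin.snoc_castSucc, Fin.snoc_last, Fin.val_castSucc, Fin.val_last]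
    ring

variable [Nonempty E] [Fintype X] [Nonempty X]

/-- One step of the chain rule. Memory contents of probability below `δ / card S` are
disregarded; the others leave a bounded posterior density of the hidden `x`, to which the second
moment bound applies. -/
lemma expect_sum_memLaw_succ_le {η δ : ℝ} (hη : 0 ≤ η) (hδ : 0 < δ) (hD : ∀ x e, 0 ≤ D x e)
    (hD1 : ∀ x, 𝔼 e, D x e = 1)
    (H : ∀ g : X → ℝ, (∀ x, 0 ≤ g x) → (∀ x, g x ≤ Fintype.card S / δ) → 𝔼 x, g x = 1 →
      𝔼 e, (𝔼 x, g x * D x e) ^ 2 ≤ 1 + η)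
    (t : ℕ) (f : S → ℝ) (hf0 : ∀ s, 0 ≤ f s) (hf1 : ∀ s, f s ≤ 1) :
    𝔼 x, ∑ s, memLaw D step s₀ (t + 1) x s * f s ≤
      𝔼 x, ∑ s, memLaw D step s₀ t x s * Real.log (𝔼 e, Real.exp (f (step t s e))) + (η + δ) := by
  set p := memLaw D step s₀ t with hp
  have hp0 : ∀ x s, 0 ≤ p x s := memLaw_nonneg D step s₀ hD t
  have hps : ∀ x, ∑ s, p x s = 1 := sum_memLaw D step s₀ hD1 t
  have hp1 : ∀ x s, p x s ≤ 1 := fun x s => by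
    rw [← hps x]
    exact Finset.single_le_sum (fun r _ => hp0 x r) (Finset.mem_univ s)
  have : Nonempty S := ⟨s₀⟩
  have hS : (0 : ℝ) < Fintype.card S := by exact_mod_cast Fintype.card_pos
  set q : S → ℝ := fun s => 𝔼 x, p x s with hq
  have hqs : ∑ s, q s = 1 := by
    rw [hq, ← Finset.expect_sum_comm]
    simp [hps]
  have hv0 : ∀ s, 0 ≤ Real.log (𝔼 e, Real.exp (f (step t s e))) := fun s => by
    refine Real.log_nonneg ?_
    rw [← Fintype.expect_const (ι := E) (1 : ℝ)]
    exact Finset.expect_le_expect fun e _ => Real.one_le_exp (hf0 _)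
  have key : ∀ s, 𝔼 x, p x s * 𝔼 e, D x e * f (step t s e) ≤
      q s * Real.log (𝔼 e, Real.exp (f (step t s e))) + (q s * η + δ / Fintype.card S) := by
    intro s
    have hq0 : 0 ≤ q s := Finset.expect_nonneg fun x _ => hp0 x s
    rcases le_or_gt (q s) (δ / Fintype.card S) with hs | hs
    · have h1 : 𝔼 x, p x s * 𝔼 e, D x e * f (step t s e) ≤ q s := by
        refine Finset.expect_le_expect fun x _ => mul_le_of_le_one_right (hp0 x s) ?_
        rw [← hD1 x]
        exact Finset.expect_le_expect fun e _ => mul_le_of_le_one_right (hD x e) (hf1 _)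
      have h2 := mul_nonneg hq0 (hv0 s)
      have h3 := mul_nonneg hq0 hη
      linarith
    · have hqp : 0 < q s := lt_of_le_of_lt (by positivity) hs
      set g : X → ℝ := fun x => p x s / q s with hg
      have hg1 : 𝔼 x, g x = 1 := by
        rw [hg, ← Finset.expect_div]; exact div_self hqp.ne'
      have h2 := H g (fun x => div_nonneg (hp0 x s) hq0) (fun x => by
        rw [hg, div_le_iff₀ hqp]
        refine (hp1 x s).trans ?_
        rw [div_lt_iff₀ hS] at hs
        rw [div_mul_eq_mul_div, le_div_iff₀ hδ]
        linarith) hg1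
      have h3 := expect_mul_le_log_expect_exp (fun e => 𝔼 x, g x * D x e)
        (fun e => f (step t s e)) (fun e => Finset.expect_nonneg fun x _ =>
          mul_nonneg (div_nonneg (hp0 x s) hq0) (hD x e)) (by
          rw [Finset.expect_comm]
          simp only [← Finset.mul_expect, hD1, mul_one, hg1]) h2
      have h4 : 𝔼 x, p x s * 𝔼 e, D x e * f (step t s e) =
          q s * 𝔼 e, (𝔼 x, g x * D x e) * f (step t s e) := by
        simp only [Finset.mul_expect, Finset.expect_mul]
        rw [Finset.expect_comm]
        refine Finset.expect_congr rfl fun e _ => Finset.expect_congr rfl fun x _ => ?_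
        rw [hg]; field_simp
      rw [h4]
      have h5 := mul_le_mul_of_nonneg_left h3 hq0
      have h6 : 0 ≤ δ / Fintype.card S := by positivity
      linarith
  have e1 : 𝔼 x, ∑ s, memLaw D step s₀ (t + 1) x s * f s =
      ∑ s, 𝔼 x, p x s * 𝔼 e, D x e * f (step t s e) := by
    rw [← Finset.expect_sum_comm]
    exact Finset.expect_congr rfl fun x _ => sum_memLaw_succ D step s₀ t x f
  have e2 : 𝔼 x, ∑ s, p x s * Real.log (𝔼 e, Real.exp (f (step t s e))) =
      ∑ s, q s * Real.log (𝔼 e, Real.exp (f (step t s e))) := by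
    rw [Finset.expect_sum_comm]
    exact Finset.sum_congr rfl fun s _ => (Finset.expect_mul _ _ _).symm
  rw [e1, e2]
  refine (Finset.sum_le_sum fun s _ => key s).trans (le_of_eq ?_)
  rw [Finset.sum_add_distrib, Finset.sum_add_distrib, ← Finset.sum_mul, hqs, Finset.sum_const,
    Finset.card_univ, nsmul_eq_mul]
  field_simp

/-- The chain rule: the bounds for single steps add up. The function `f` is pulled back along the
stream by the logarithmic Laplace transform, which keeps its values in `[0, 1]`. -/
theorem expect_sum_memLaw_le {η δ : ℝ} (hη : 0 ≤ η) (hδ : 0 < δ) (hD : ∀ x e, 0 ≤ D x e)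
    (hD1 : ∀ x, 𝔼 e, D x e = 1)
    (H : ∀ g : X → ℝ, (∀ x, 0 ≤ g x) → (∀ x, g x ≤ Fintype.card S / δ) → 𝔼 x, g x = 1 →
      𝔼 e, (𝔼 x, g x * D x e) ^ 2 ≤ 1 + η)
    (t : ℕ) (f : S → ℝ) (hf0 : ∀ s, 0 ≤ f s) (hf1 : ∀ s, f s ≤ 1) :
    𝔼 x, ∑ s, memLaw D step s₀ t x s * f s ≤
      Real.log (∑ s, memLaw (fun (_ : Unit) _ => 1) step s₀ t () s * Real.exp (f s)) +
        t * (η + δ) := by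
  induction t generalizing f with
  | zero => simp [memLaw]
  | succ t ih =>
    refine (expect_sum_memLaw_succ_le D step s₀ hη hδ hD hD1 H t f hf0 hf1).trans ?_
    have hpos : ∀ s, 0 < 𝔼 e, Real.exp (f (step t s e)) := fun s =>
      Finset.expect_pos (fun e _ => Real.exp_pos _) Finset.univ_nonempty
    have h := ih (fun s => Real.log (𝔼 e, Real.exp (f (step t s e))))
      (fun s => by
        refine Real.log_nonneg ?_
        rw [← Fintype.expect_const (ι := E) (1 : ℝ)]
        exact Finset.expect_le_expect fun e _ => Real.one_le_exp (hf0 _))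
      (fun s => by
        rw [Real.log_le_iff_le_exp (hpos s), ← Fintype.expect_const (ι := E) (Real.exp 1)]
        exact Finset.expect_le_expect fun e _ => Real.exp_le_exp.2 (hf1 _))
    simp only [Real.exp_log (hpos _)] at h
    rw [sum_memLaw_succ (fun (_ : Unit) _ => 1) step s₀ t () fun s => Real.exp (f s)]
    simp only [one_mul]
    push_cast
    linarith

/-- An event for the final memory content cannot be likely under the hidden-variable distribution
and unlikely under the uniform one. -/
theorem expect_foldl_le {η δ : ℝ} (hη : 0 ≤ η) (hδ : 0 < δ) (hD : ∀ x e, 0 ≤ D x e)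
    (hD1 : ∀ x, 𝔼 e, D x e = 1)
    (H : ∀ g : X → ℝ, (∀ x, 0 ≤ g x) → (∀ x, g x ≤ Fintype.card S / δ) → 𝔼 x, g x = 1 →
      𝔼 e, (𝔼 x, g x * D x e) ^ 2 ≤ 1 + η)
    (t : ℕ) (f : S → ℝ) (hf : ∀ s, f s = 0 ∨ f s = 1) :
    𝔼 x, 𝔼 e : Fin t → E,
        (∏ i, D x (e i)) * f (Fin.foldl t (fun s i => step i s (e i)) s₀) ≤
      (Real.exp 1 - 1) * 𝔼 e : Fin t → E, f (Fin.foldl t (fun s i => step i s (e i)) s₀) +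
        t * (η + δ) := by
  have h := expect_sum_memLaw_le D step s₀ hη hδ hD hD1 H t f
    (fun s => by rcases hf s with h | h <;> rw [h]; norm_num)
    (fun s => by rcases hf s with h | h <;> rw [h]; norm_num)
  have h1 := expect_foldl (fun (_ : Unit) (_ : E) => (1 : ℝ)) step s₀ t () f
  simp only [Finset.prod_const_one, one_mul] at h1
  simp only [expect_foldl, h1]
  refine h.trans (add_le_add_left ?_ _)
  have e : ∀ s, Real.exp (f s) = 1 + (Real.exp 1 - 1) * f s := fun s => by
    rcases hf s with h | h <;> rw [h] <;> simp
  simp only [e, mul_add, mul_one, Finset.sum_add_distrib]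
  rw [sum_memLaw (fun (_ : Unit) (_ : E) => (1 : ℝ)) step s₀ (fun _ => Fintype.expect_const 1)]
  simp only [mul_left_comm _ (Real.exp 1 - 1), ← Finset.mul_sum]
  have hQ : 0 ≤ ∑ s, memLaw (fun (_ : Unit) (_ : E) => (1 : ℝ)) step s₀ t () s * f s :=
    Finset.sum_nonneg fun s _ => mul_nonneg
      (memLaw_nonneg _ step s₀ (fun _ _ => zero_le_one) t () s)
      (by rcases hf s with h | h <;> rw [h]; norm_num)
  have h2 : 0 ≤ (Real.exp 1 - 1) *
      ∑ s, memLaw (fun (_ : Unit) (_ : E) => (1 : ℝ)) step s₀ t () s * f s :=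
    mul_nonneg (by linarith [Real.add_one_le_exp 1]) hQ
  have := Real.log_le_sub_one_of_pos (show 0 < 1 + (Real.exp 1 - 1) *
      ∑ s, memLaw (fun (_ : Unit) (_ : E) => (1 : ℝ)) step s₀ t () s * f s by linarith)
  linarith

end Streams

/-! ### Cutting a stream into chunks -/

lemma foldl_ofFn_eq_finFoldl {α β : Type*} {m : ℕ} (p : Fin m → α) (h : β → α → β) (s : β) :
    (List.ofFn p).foldl h s = Fin.foldl m (fun s i => h s (p i)) s := by
  rw [Fin.foldl_eq_finRange_foldl, List.ofFn_eq_map, List.foldl_map]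

lemma foldl_mul {L S : Type*} (T m : ℕ) (step : ℕ → S → L → S) (s₀ : S) (e : Fin (T * m) → L) :
    Fin.foldl (T * m) (fun s i => step i s (e i)) s₀ =
      Fin.foldl T (fun s i => Fin.foldl m
        (fun s j => step (i * m + j) s (e (finProdFinEquiv (i, j)))) s) s₀ := by
  have h := foldl_ofFn_eq_finFoldl (fun i : Fin (T * m) => (i.val, e i)) (fun s q => step q.1 s q.2) s₀
  rw [← h, List.ofFn_mul, List.foldl_flatten, foldl_ofFn_eq_finFoldl]
  congr 1
  funext s i
  rw [foldl_ofFn_eq_finFoldl]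
  congr 1
  funext s j
  congr 2
  exact congrArg e (Fin.ext (by simp [mul_comm, add_comm]))

/-- Reading a stream of length `T * m` as a sequence of `T` chunks of length `m`. -/
def chunkEquiv (L : Type*) (T m : ℕ) : (Fin T → Fin m → L) ≃ (Fin (T * m) → L) :=
  (Equiv.curry (Fin T) (Fin m) L).symm.trans (finProdFinEquiv.arrowCongr (Equiv.refl L))

lemma chunkEquiv_apply {L : Type*} {T m : ℕ} (e : Fin T → Fin m → L) (i : Fin T) (j : Fin m) :
    chunkEquiv L T m e (finProdFinEquiv (i, j)) = e i j := by
  simp [chunkEquiv, Equiv.arrowCongr]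

lemma chunkDens_chunkEquiv {k T m : ℕ} (x : Fin k → Bool) (e : Fin T → Fin m → Label k) :
    chunkDens x (chunkEquiv (Label k) T m e) = ∏ i, chunkDens x (e i) := by
  simp only [chunkDens]
  rw [← finProdFinEquiv.prod_comp, ← Finset.univ_product_univ, Finset.prod_product]
  simp only [chunkEquiv_apply]

/-- A stream of edges compatible with a hidden colouring cannot be told from a uniformly random
one by a deterministic algorithm with few memory states. -/
theorem expect_chunkDens_foldl_le {S : Type*} [Fintype S] [DecidableEq S] {k m T : ℕ} (hk : 0 < k)
    {a δ : ℝ} (hδ : 0 < δ) (hma : (m : ℝ) / k ≤ a) (ha : a ≤ 1 / 16)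
    (hS : 4 * √(2 * a / k) * Real.log (Fintype.card S / δ) ≤ a ^ 2)
    (step : ℕ → S → Label k → S) (s₀ : S) (f : S → ℝ) (hf : ∀ s, f s = 0 ∨ f s = 1) :
    𝔼 x, 𝔼 e : Fin (T * m) → Label k,
        chunkDens x e * f (Fin.foldl (T * m) (fun s i => step i s (e i)) s₀) ≤
      (Real.exp 1 - 1) *
        𝔼 e : Fin (T * m) → Label k, f (Fin.foldl (T * m) (fun s i => step i s (e i)) s₀) +
        T * ((Real.exp (10 * a ^ 2) - 1) + δ) := by
  have : Nonempty (Fin k) := ⟨⟨0, hk⟩⟩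
  have h := expect_foldl_le (fun (x : Fin k → Bool) (e : Fin m → Label k) => chunkDens x e)
    (fun i s e => Fin.foldl m (fun s j => step (i * m + j) s (e j)) s) s₀
    (η := Real.exp (10 * a ^ 2) - 1) (δ := δ) (sub_nonneg.2 (Real.one_le_exp (by positivity))) hδ
    chunkDens_nonneg (expect_chunkDens hk m)
    (fun g hg hgM hg1 => by
      rw [add_sub_cancel]
      exact chunk_second_moment hk hma ha hS g hg hgM hg1) T f hf
  have key : ∀ w : (Fin (T * m) → Label k) → ℝ,
      𝔼 e : Fin (T * m) → Label k, w e * f (Fin.foldl (T * m) (fun s i => step i s (e i)) s₀) =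
      𝔼 e : Fin T → Fin m → Label k, w (chunkEquiv _ T m e) *
        f (Fin.foldl T (fun s i => Fin.foldl m (fun s j => step (i * m + j) s (e i j)) s) s₀) := by
    intro w
    refine (Fintype.expect_equiv (chunkEquiv (Label k) T m) _ _ fun e => ?_).symm
    rw [foldl_mul]
    simp only [chunkEquiv_apply]
  have key1 := key fun _ => 1
  simp only [one_mul] at key1
  rw [key1]
  refine le_trans (le_of_eq ?_) h
  refine Finset.expect_congr rfl fun x _ => ?_
  rw [key fun e => chunkDens x e]
  simp only [chunkDens_chunkEquiv]

/-! ### The random multigraphs -/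

section Graphs

variable {n k : ℕ}

/-- The vertex `(i, a)`, as a number below `2 * k ≤ n`. -/
def vtx (hk : 2 * k ≤ n) (i : Fin k) (a : Bool) : Fin n :=
  ⟨2 * i + a.toNat, by have := a.toNat_le; omega⟩

lemma vtx_inj (hk : 2 * k ≤ n) {i j : Fin k} {a b : Bool} :
    vtx hk i a = vtx hk j b ↔ i = j ∧ a = b := by
  constructor
  · intro h
    have h' := congrArg Fin.val h
    simp only [vtx] at h'
    have ha := a.toNat_le
    have hb := b.toNat_le
    refine ⟨Fin.ext (by omega), ?_⟩
    have : a.toNat = b.toNat := by omega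
    cases a <;> cases b <;> simp_all
  · rintro ⟨rfl, rfl⟩; rfl

/-- The edge with a given label. -/
def labelEdge (hk : 2 * k ≤ n) (e : Label k) : Sym2 (Fin n) :=
  if e.1 = e.2.1 then s(vtx hk e.1 true, vtx hk e.1 false)
  else s(vtx hk e.1 e.2.2.1, vtx hk e.2.1 e.2.2.2)

lemma labelEdge_not_isDiag (hk : 2 * k ≤ n) (e : Label k) : ¬ (labelEdge hk e).IsDiag := by
  unfold labelEdge
  split_ifs with h
  · simp [vtx_inj]
  · simp [vtx_inj, h]

/-- The multigraph whose edges have the given labels. -/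
def labelGraph (hk : 2 * k ≤ n) {m : ℕ} (e : Fin m → Label k) : MultiG n where
  m := m
  edge i := labelEdge hk (e i)
  loopless i := labelEdge_not_isDiag hk (e i)

/-- One side of the bipartition given by a hidden colouring. -/
def hiddenSide (hk : 2 * k ≤ n) (x : Fin k → Bool) : Finset (Fin n) :=
  Finset.univ.image fun i => vtx hk i (x i)

lemma vtx_mem_hiddenSide (hk : 2 * k ≤ n) (x : Fin k → Bool) (i : Fin k) (a : Bool) :
    vtx hk i a ∈ hiddenSide hk x ↔ a = x i := by
  simp only [hiddenSide, Finset.mem_image, Finset.mem_univ, true_and, vtx_inj]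
  constructor
  · rintro ⟨j, rfl, rfl⟩; rfl
  · rintro rfl; exact ⟨i, rfl, rfl⟩

lemma crosses_mk {S : Finset (Fin n)} {u v : Fin n} :
    Crosses S s(u, v) ↔ (u ∈ S ∧ v ∉ S) ∨ (v ∈ S ∧ u ∉ S) := by
  unfold Crosses
  constructor
  · rintro ⟨a, b, ha, hb, h⟩
    rcases Sym2.eq_iff.1 h with ⟨rfl, rfl⟩ | ⟨rfl, rfl⟩
    · exact Or.inl ⟨ha, hb⟩
    · exact Or.inr ⟨ha, hb⟩
  · rintro (⟨h1, h2⟩ | ⟨h1, h2⟩)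
    · exact ⟨u, v, h1, h2, rfl⟩
    · exact ⟨v, u, h1, h2, Sym2.eq_swap⟩

lemma crosses_hiddenSide (hk : 2 * k ≤ n) (x : Fin k → Bool) (e : Label k) (he : dens x e ≠ 0) :
    Crosses (hiddenSide hk x) (labelEdge hk e) := by
  obtain ⟨i, j, a, b⟩ := e
  unfold labelEdge
  simp only [dens] at he
  split_ifs with h
  · rw [crosses_mk, vtx_mem_hiddenSide, vtx_mem_hiddenSide]
    cases x i <;> simp
  · rw [crosses_mk]
    simp only [vtx_mem_hiddenSide]
    simp only [h, if_false] at he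
    revert he
    cases x i <;> cases x j <;> cases a <;> cases b <;> simp

lemma labelGraph_isBipartite (hk : 2 * k ≤ n) {m : ℕ} (x : Fin k → Bool) (e : Fin m → Label k)
    (he : chunkDens x e ≠ 0) : (labelGraph hk e).IsBipartite :=
  ⟨hiddenSide hk x, fun i _ =>
    crosses_hiddenSide hk x (e i) (Finset.prod_ne_zero_iff.1 he i (Finset.mem_univ _))⟩

lemma MultiG.IsBipartite.maxCut_eq {G : MultiG n} (h : G.IsBipartite) : G.maxCut = G.m := by
  classical
  obtain ⟨S, hS⟩ := h
  refine le_antisymm (Finset.sup_le fun T _ => ?_) ?_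
  · exact (Finset.card_filter_le _ _).trans_eq (by simp)
  · refine le_trans (le_of_eq ?_) (Finset.le_sup (f := G.cutSize) (Finset.mem_univ S))
    rw [MultiG.cutSize, Finset.filter_true_of_mem hS]
    simp

lemma MultiG.isFar_of_maxCut_le {G : MultiG n} {δ : ℝ} (h : (G.maxCut : ℝ) ≤ (1 / 2 + δ) * G.m) :
    G.IsFar (1 / 2 - δ) := by
  classical
  rintro A ⟨S, hS⟩
  have h1 : A.card ≤ G.cutSize S :=
    Finset.card_le_card fun i hi => Finset.mem_filter.2 ⟨Finset.mem_univ _, hS i hi⟩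
  have h2 : G.cutSize S ≤ G.maxCut := Finset.le_sup (f := G.cutSize) (Finset.mem_univ S)
  have h3 : (A.card : ℝ) ≤ G.maxCut := by exact_mod_cast h1.trans h2
  linarith

open Classical in
/-- A uniformly random labelled edge crosses any fixed cut with probability at most
`1 / 2 + 1 / k`. -/
lemma expect_crosses_le (hk : 2 * k ≤ n) (hk0 : 0 < k) (S : Finset (Fin n)) :
    𝔼 e : Label k, (if Crosses S (labelEdge hk e) then (1 : ℝ) else 0) ≤ 1 / 2 + 1 / k := by
  have : Nonempty (Fin k) := ⟨⟨0, hk0⟩⟩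
  set y : Fin n → ℝ := fun v => if v ∈ S then 1 else -1 with hy
  have hyv : ∀ v, y v = 1 ∧ v ∈ S ∨ y v = -1 ∧ v ∉ S := fun v => by
    simp only [hy]; split_ifs with h <;> simp [h]
  set d : Fin k → Fin k → ℝ := fun i j => if i = j then 1 else 0 with hd
  have h1 : ∀ e : Label k, (if Crosses S (labelEdge hk e) then (1 : ℝ) else 0) ≤
      1 / 2 - 1 / 2 * (y (vtx hk e.1 e.2.2.1) * y (vtx hk e.2.1 e.2.2.2)) +
        d e.1 e.2.1 := by
    rintro ⟨i, j, a, b⟩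
    unfold labelEdge
    dsimp only
    by_cases hij : i = j
    · rw [if_pos hij, show d i j = 1 from if_pos hij]
      refine le_trans (b := 1) (by split_ifs <;> norm_num) ?_
      rcases hyv (vtx hk i a) with ⟨h, -⟩ | ⟨h, -⟩ <;>
        rcases hyv (vtx hk j b) with ⟨h', -⟩ | ⟨h', -⟩ <;> rw [h, h'] <;> norm_num
    · rw [if_neg hij, crosses_mk, show d i j = 0 from if_neg hij]
      rcases hyv (vtx hk i a) with ⟨h, h0⟩ | ⟨h, h0⟩ <;>
        rcases hyv (vtx hk j b) with ⟨h', h0'⟩ | ⟨h', h0'⟩ <;> rw [h, h'] <;> simp [h0, h0'] <;>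
        norm_num
  refine (Finset.expect_le_expect fun e _ => h1 e).trans ?_
  rw [expect_label]
  simp only [Finset.expect_sub_distrib, Finset.expect_add_distrib, Fintype.expect_const,
    ← Finset.mul_expect]
  have h2 : 𝔼 i, 𝔼 j, 𝔼 a, 𝔼 b, y (vtx hk i a) * y (vtx hk j b) =
      (𝔼 i, 𝔼 a, y (vtx hk i a)) ^ 2 := by
    rw [sq, Fintype.expect_mul_expect]
    refine Finset.expect_congr rfl fun i _ => Finset.expect_congr rfl fun j _ => ?_
    rw [Fintype.expect_mul_expect]
  have h3 : 𝔼 i, 𝔼 j, d i j = 1 / k := by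
    have hk' : (k : ℝ) ≠ 0 := by positivity
    simp only [hd, Fintype.expect_eq_sum_div_card, Finset.sum_ite_eq, Finset.mem_univ, if_true,
      Fintype.card_fin, Finset.sum_const, Finset.card_univ, nsmul_eq_mul]
    field_simp
  simp only [← Finset.mul_expect] at h2
  rw [h2, h3]
  have := sq_nonneg (𝔼 i, 𝔼 a, y (vtx hk i a))
  linarith

/-- A Chernoff bound for sums of independent indicators of probability at most
`(1 + δ) / 2`. -/
lemma chernoff {I : Type*} [Fintype I] [Nonempty I] (m : ℕ) {δ : ℝ} (hδ0 : 0 < δ) (hδ1 : δ ≤ 1)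
    (c : I → ℝ) (hc : ∀ i, c i = 0 ∨ c i = 1) (hc1 : 𝔼 i, c i ≤ 1 / 2 + δ / 2) :
    𝔼 e : Fin m → I, (if (1 / 2 + δ) * m < ∑ i, c (e i) then (1 : ℝ) else 0) ≤
      Real.exp (-(δ ^ 2 / 16 * m)) := by
  set l := δ / 4 with hl
  have hl0 : 0 < l := by positivity
  have hexp : Real.exp l ≤ 1 + l + l ^ 2 := by
    have := Real.abs_exp_sub_one_sub_id_le (x := l) (by rw [abs_of_pos hl0]; linarith)
    linarith [(abs_le.1 this).2]
  have h1 : ∀ e : Fin m → I, (if (1 / 2 + δ) * m < ∑ i, c (e i) then (1 : ℝ) else 0) ≤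
      Real.exp (-(l * ((1 / 2 + δ) * m))) * ∏ i, Real.exp (l * c (e i)) := by
    intro e
    rw [← Real.exp_sum, ← Finset.mul_sum, ← Real.exp_add]
    split_ifs with h
    · refine Real.one_le_exp ?_
      nlinarith
    · positivity
  refine (Finset.expect_le_expect fun e _ => h1 e).trans ?_
  rw [← Finset.mul_expect, expect_pi_prod m fun i => Real.exp (l * c i)]
  have h2 : 𝔼 i, Real.exp (l * c i) ≤ Real.exp ((l + l ^ 2) * (1 / 2 + δ / 2)) := by
    calc 𝔼 i, Real.exp (l * c i) = 𝔼 i, (1 + (Real.exp l - 1) * c i) := by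
          refine Finset.expect_congr rfl fun i _ => ?_
          rcases hc i with h | h <;> rw [h] <;> simp
      _ = 1 + (Real.exp l - 1) * 𝔼 i, c i := by
          rw [Finset.expect_add_distrib, Fintype.expect_const, Finset.mul_expect]
      _ ≤ 1 + (l + l ^ 2) * (1 / 2 + δ / 2) := by
          have h0 : 0 ≤ 𝔼 i, c i := Finset.expect_nonneg fun i _ => by
            rcases hc i with h | h <;> rw [h]; norm_num
          have : Real.exp l - 1 ≤ l + l ^ 2 := by linarith
          nlinarith [mul_le_mul this hc1 h0 (by positivity)]
      _ ≤ _ := by rw [add_comm]; exact Real.add_one_le_exp _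
  have h3 : 0 ≤ 𝔼 i, Real.exp (l * c i) := Finset.expect_nonneg fun i _ => (Real.exp_pos _).le
  refine (mul_le_mul_of_nonneg_left (pow_le_pow_left₀ h3 h2 m) (Real.exp_pos _).le).trans ?_
  rw [← Real.exp_nat_mul, ← Real.exp_add, Real.exp_le_exp]
  have hm : (0 : ℝ) ≤ m := Nat.cast_nonneg m
  have h4 : -(l * (1 / 2 + δ)) + (l + l ^ 2) * (1 / 2 + δ / 2) ≤ -(δ ^ 2 / 16) := by
    rw [hl]; nlinarith [mul_nonneg (sq_nonneg δ) (sub_nonneg.2 hδ1)]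
  nlinarith [mul_le_mul_of_nonneg_right h4 hm]

/-- A random multigraph with sufficiently many edges has no cut with much more than half of
them. -/
lemma expect_maxCut_gt_le (hk : 2 * k ≤ n) (hk0 : 0 < k) (m : ℕ) {δ : ℝ} (hδ0 : 0 < δ)
    (hδ1 : δ ≤ 1) (hkδ : 2 / k ≤ δ) :
    𝔼 e : Fin m → Label k,
        (if (1 / 2 + δ) * m < ((labelGraph hk e).maxCut : ℝ) then (1 : ℝ) else 0) ≤
      2 ^ n * Real.exp (-(δ ^ 2 / 16 * m)) := by
  classical
  have : Nonempty (Fin k) := ⟨⟨0, hk0⟩⟩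
  set c : Finset (Fin n) → Label k → ℝ :=
    fun S e => if Crosses S (labelEdge hk e) then 1 else 0 with hc
  have hcut : ∀ (S : Finset (Fin n)) (e : Fin m → Label k),
      ((labelGraph hk e).cutSize S : ℝ) = ∑ i, c S (e i) := by
    intro S e
    simp only [MultiG.cutSize, hc, Finset.sum_boole]
    rfl
  have h1 : ∀ e : Fin m → Label k,
      (if (1 / 2 + δ) * m < ((labelGraph hk e).maxCut : ℝ) then (1 : ℝ) else 0) ≤
        ∑ S, if (1 / 2 + δ) * m < ∑ i, c S (e i) then (1 : ℝ) else 0 := by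
    intro e
    have h0 : ∀ S ∈ (Finset.univ : Finset (Finset (Fin n))),
        0 ≤ if (1 / 2 + δ) * m < ∑ i, c S (e i) then (1 : ℝ) else 0 := fun S _ => by
      split_ifs <;> norm_num
    split_ifs with h
    · obtain ⟨S, -, hS⟩ := Finset.exists_mem_eq_sup (Finset.univ : Finset (Finset (Fin n)))
        Finset.univ_nonempty (labelGraph hk e).cutSize
      rw [MultiG.maxCut, hS, hcut] at h
      refine le_trans (le_of_eq ?_) (Finset.single_le_sum h0 (Finset.mem_univ S))
      rw [if_pos h]
    · exact Finset.sum_nonneg h0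
  refine (Finset.expect_le_expect fun e _ => h1 e).trans ?_
  rw [Finset.expect_sum_comm]
  refine (Finset.sum_le_sum fun S _ => chernoff m hδ0 hδ1 (c S)
    (fun i => by simp only [hc]; split_ifs <;> simp) ?_).trans (le_of_eq ?_)
  · refine (expect_crosses_le hk hk0 S).trans ?_
    have : (1 : ℝ) / k = 2 / k / 2 := by ring
    linarith
  · simp

end Graphs

/-! ### Randomized algorithms and random order -/

namespace StreamAlg

variable {n s : ℕ} {α : Type*} [MeasurableSpace α] {Ω : Type*} [MeasurableSpace Ω]

lemma measurable_foldl (A : StreamAlg n s α Ω) {m : ℕ} (x : Fin m → Sym2 (Fin n)) :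
    Measurable fun ω => Fin.foldl m (fun mem i => A.step ω i mem (x i)) (A.init ω) := by
  induction m with
  | zero => simpa using A.measurable_init
  | succ m ih =>
    simp only [Fin.foldl_succ_last]
    have h : Measurable fun p : Ω × (Fin s → Bool) =>
        A.step p.1 (Fin.last m) p.2 (x (Fin.last m)) :=
      measurable_from_prod_countable_left fun mem => A.measurable_step _ mem _
    exact h.comp (measurable_id.prodMk (ih fun i => x i.castSucc))

lemma measurable_run (A : StreamAlg n s α Ω) {m : ℕ} (x : Fin m → Sym2 (Fin n)) :
    Measurable fun ω => A.run ω x := by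
  have h : Measurable fun p : Ω × (Fin s → Bool) => A.answer p.1 m p.2 :=
    measurable_from_prod_countable_left fun mem => A.measurable_answer _ mem
  exact h.comp (measurable_id.prodMk (A.measurable_foldl x))

variable (A : StreamAlg n s α Ω) (P : Measure Ω)

lemma prob_eq_expect (G : MultiG n) (B : Set α) :
    A.prob P G B =
      𝔼 σ : Equiv.Perm (Fin G.m), P.real {ω | A.run ω (fun i => G.edge (σ i)) ∈ B} := by
  rw [prob, Fintype.expect_eq_sum_div_card]

lemma prob_mono [IsProbabilityMeasure P] (G : MultiG n) {B C : Set α} (h : B ⊆ C) :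
    A.prob P G B ≤ A.prob P G C := by
  rw [prob_eq_expect, prob_eq_expect]
  exact Finset.expect_le_expect fun σ _ => measureReal_mono fun ω hω => h hω

lemma prob_add_prob_compl [IsProbabilityMeasure P] (G : MultiG n) {B : Set α}
    (hB : MeasurableSet B) : A.prob P G B + A.prob P G Bᶜ = 1 := by
  rw [prob_eq_expect, prob_eq_expect, ← Finset.expect_add_distrib]
  refine (Finset.expect_congr rfl fun σ _ => ?_).trans (Fintype.expect_const 1)
  exact measureReal_add_measureReal_compl (A.measurable_run _ hB) |>.trans (by simp)

lemma prob_nonneg (G : MultiG n) (B : Set α) : 0 ≤ A.prob P G B := by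
  rw [prob_eq_expect]
  exact Finset.expect_nonneg fun σ _ => measureReal_nonneg

/-- For an exchangeable distribution on streams, the random order makes no difference. -/
lemma expect_mul_prob_labelGraph {k m : ℕ} (hk : 2 * k ≤ n) (w : (Fin m → Label k) → ℝ)
    (hw : ∀ (e : Fin m → Label k) (σ : Equiv.Perm (Fin m)), w (fun i => e (σ i)) = w e)
    (B : Set α) :
    𝔼 e, w e * A.prob P (labelGraph hk e) B =
      𝔼 e, w e * P.real {ω | A.run ω (fun i => labelEdge hk (e i)) ∈ B} := by
  have h1 : ∀ e : Fin m → Label k, w e * A.prob P (labelGraph hk e) B =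
      𝔼 σ : Equiv.Perm (Fin m),
        w e * P.real {ω | A.run ω (fun i => labelEdge hk (e (σ i))) ∈ B} := by
    intro e
    rw [← Finset.mul_expect]
    exact congrArg _ (A.prob_eq_expect P (labelGraph hk e) B)
  simp only [h1]
  rw [Finset.expect_comm]
  refine (Finset.expect_congr rfl fun σ _ => ?_).trans (Fintype.expect_const _)
  refine Fintype.expect_equiv (σ.symm.arrowCongr (Equiv.refl _)) _ _ fun e => ?_
  rw [show (σ.symm.arrowCongr (Equiv.refl _)) e = fun i => e (σ i) from rfl, hw]

end StreamAlg

lemma integrable_expect_indicator {Ω I : Type*} [MeasurableSpace Ω] [Fintype I] (P : Measure Ω)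
    [IsProbabilityMeasure P] (w : I → ℝ) {U : I → Set Ω} (hU : ∀ i, MeasurableSet (U i)) :
    Integrable (fun ω => 𝔼 i, w i * (U i).indicator (fun _ => (1 : ℝ)) ω) P := by
  simp only [Fintype.expect_eq_sum_div_card]
  exact (integrable_finsetSum _ fun i _ =>
    ((integrable_const 1).indicator (hU i)).const_mul _).div_const _

lemma integral_expect_indicator {Ω I : Type*} [MeasurableSpace Ω] [Fintype I] (P : Measure Ω)
    [IsProbabilityMeasure P] (w : I → ℝ) {U : I → Set Ω} (hU : ∀ i, MeasurableSet (U i)) :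
    ∫ ω, 𝔼 i, w i * (U i).indicator (fun _ => (1 : ℝ)) ω ∂P = 𝔼 i, w i * P.real (U i) := by
  simp only [Fintype.expect_eq_sum_div_card]
  rw [integral_div, integral_finsetSum _ fun i _ =>
    ((integrable_const 1).indicator (hU i)).const_mul _]
  congr 1
  refine Finset.sum_congr rfl fun i _ => ?_
  rw [integral_const_mul, integral_indicator (hU i)]
  simp

/-- The bound for deterministic algorithms, averaged over the seed. -/
theorem expect_chunkDens_mul_prob_le {n s : ℕ} {α : Type*} [MeasurableSpace α] {Ω : Type*}
    [MeasurableSpace Ω] (A : StreamAlg n s α Ω) (P : Measure Ω) [IsProbabilityMeasure P]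
    {B : Set α} (hB : MeasurableSet B) {k m T : ℕ} (hk : 2 * k ≤ n) (hk0 : 0 < k)
    {a δ : ℝ} (hδ : 0 < δ) (hma : (m : ℝ) / k ≤ a) (ha : a ≤ 1 / 16)
    (hS : 4 * √(2 * a / k) * Real.log (2 ^ s / δ) ≤ a ^ 2) :
    𝔼 x, 𝔼 e : Fin (T * m) → Label k, chunkDens x e * A.prob P (labelGraph hk e) B ≤
      (Real.exp 1 - 1) * 𝔼 e : Fin (T * m) → Label k, A.prob P (labelGraph hk e) B +
        T * ((Real.exp (10 * a ^ 2) - 1) + δ) := by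
  classical
  have : Nonempty (Fin k) := ⟨⟨0, hk0⟩⟩
  set U : (Fin (T * m) → Label k) → Set Ω :=
    fun e => {ω | A.run ω (fun i => labelEdge hk (e i)) ∈ B} with hUdef
  have hU : ∀ e, MeasurableSet (U e) := fun e => A.measurable_run _ hB
  have h1 := A.expect_mul_prob_labelGraph P hk (m := T * m) (fun _ => 1) (fun _ _ => rfl) B
  simp only [one_mul] at h1
  have h2 : ∀ x : Fin k → Bool, _ := fun x =>
    A.expect_mul_prob_labelGraph P hk (m := T * m) (fun e => chunkDens x e)
      (fun e σ => Equiv.prod_comp σ fun i => dens x (e i)) B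
  simp only [h1, h2]
  have i1 := integral_expect_indicator P (fun _ => 1) hU
  have j1 := integrable_expect_indicator P (fun _ => 1) hU
  have i2 := integral_expect_indicator P
    (fun q : (Fin k → Bool) × (Fin (T * m) → Label k) => chunkDens q.1 q.2)
    (U := fun q => U q.2) fun q => hU q.2
  have j2 := integrable_expect_indicator P
    (fun q : (Fin k → Bool) × (Fin (T * m) → Label k) => chunkDens q.1 q.2)
    (U := fun q => U q.2) fun q => hU q.2
  simp only [← Finset.univ_product_univ, Finset.expect_product] at i2 j2
  simp only [one_mul] at i1 j1
  rw [← i1, ← i2, ← integral_const_mul]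
  have e3 : (T : ℝ) * ((Real.exp (10 * a ^ 2) - 1) + δ) =
      ∫ _, (T : ℝ) * ((Real.exp (10 * a ^ 2) - 1) + δ) ∂P := by simp
  rw [e3, ← integral_add (j1.const_mul _) (integrable_const _)]
  refine integral_mono j2 ((j1.const_mul _).add (integrable_const _)) fun ω => ?_
  have hdet := expect_chunkDens_foldl_le (S := Fin s → Bool) (T := T) hk0 hδ hma ha
    (by simpa using hS) (fun t mem l => A.step ω t mem (labelEdge hk l)) (A.init ω)
    (fun mem => if A.answer ω (T * m) mem ∈ B then 1 else 0)
    (fun mem => by split_ifs <;> simp)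
  exact hdet

/-! ### The lower bound -/

lemma two_pow_mul_exp_neg_le {n : ℕ} (hn : (5 : ℝ) ≤ n) {x : ℝ} (hx : 2 * (n : ℝ) ≤ x) :
    (2 : ℝ) ^ n * Real.exp (-x) ≤ 1 / 100 := by
  have h5 : (2 : ℝ) ^ n ≤ Real.exp n := by
    rw [← mul_one (n : ℝ), Real.exp_nat_mul]
    exact pow_le_pow_left₀ (by norm_num) (by linarith [Real.add_one_le_exp 1]) n
  have h8 : (100 : ℝ) ≤ Real.exp 5 := by
    have h7 := Real.exp_one_gt_d9
    have h9 : Real.exp 5 = Real.exp 1 ^ 5 := by rw [← Real.exp_nat_mul]; norm_num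
    rw [h9]
    exact le_trans (by norm_num : (100 : ℝ) ≤ 2.7 ^ 5)
      (pow_le_pow_left₀ (by norm_num) (by linarith) 5)
  calc (2 : ℝ) ^ n * Real.exp (-x) ≤ Real.exp n * Real.exp (-x) :=
        mul_le_mul_of_nonneg_right h5 (Real.exp_pos _).le
    _ = Real.exp (n - x) := by rw [← Real.exp_add, sub_eq_add_neg]
    _ ≤ Real.exp (-5) := Real.exp_le_exp.2 (by linarith)
    _ ≤ 1 / 100 := by
      rw [Real.exp_neg, ← one_div]
      exact one_div_le_one_div_of_le (by norm_num) h8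

lemma error_le_half {T a : ℝ} (hT : 0 < T) (ha : 10 * a ^ 2 ≤ 1) (hTa : T * (20 * a ^ 2) = 1 / 4) :
    T * ((Real.exp (10 * a ^ 2) - 1) + 1 / (8 * T)) ≤ 1 / 2 := by
  have h2 : |10 * a ^ 2| = 10 * a ^ 2 := abs_of_nonneg (by positivity)
  have h3 := Real.abs_exp_sub_one_le (x := 10 * a ^ 2) (by rwa [h2])
  rw [h2] at h3
  have h1 : Real.exp (10 * a ^ 2) - 1 ≤ 20 * a ^ 2 := by
    linarith [le_abs_self (Real.exp (10 * a ^ 2) - 1)]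
  have h5 : T * (1 / (8 * T)) = 1 / 8 := by field_simp
  have h6 := mul_le_mul_of_nonneg_left h1 hT.le
  rw [mul_add, h5]
  linarith

lemma log_two_pow_div_le (s : ℕ) {T : ℝ} (hT : 0 < T) :
    Real.log (2 ^ s / (1 / (8 * T))) ≤ s + 8 * T := by
  rw [div_div_eq_mul_div, div_one, Real.log_mul (by positivity) (by positivity), Real.log_pow]
  have h2 := Real.log_le_sub_one_of_pos (show (0 : ℝ) < 8 * T by positivity)
  have h4 : Real.log 2 ≤ 1 := by linarith [Real.log_le_sub_one_of_pos (zero_lt_two' ℝ)]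
  have h5 : (s : ℝ) * Real.log 2 ≤ s := mul_le_of_le_one_right (Nat.cast_nonneg s) h4
  linarith

lemma le_expect_chunkDens_mul_prob {n s : ℕ} {α : Type*} [MeasurableSpace α] {Ω : Type*}
    [MeasurableSpace Ω] (A : StreamAlg n s α Ω) (P : Measure Ω) (B : Set α) {k : ℕ}
    (hk : 2 * k ≤ n) (hk0 : 0 < k) (m : ℕ)
    (h : ∀ G : MultiG n, G.m = m → G.IsBipartite → 99 / 100 ≤ A.prob P G B) :
    99 / 100 ≤ 𝔼 x, 𝔼 e : Fin m → Label k, chunkDens x e * A.prob P (labelGraph hk e) B := by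
  rw [← Fintype.expect_const (ι := Fin k → Bool) (99 / 100 : ℝ)]
  refine Finset.expect_le_expect fun x _ => ?_
  rw [← one_mul (99 / 100 : ℝ), ← expect_chunkDens hk0 m x, Finset.expect_mul]
  refine Finset.expect_le_expect fun e _ => ?_
  rcases eq_or_ne (chunkDens x e) 0 with h0 | h0
  · simp [h0]
  · exact mul_le_mul_of_nonneg_left (h _ rfl (labelGraph_isBipartite hk x e h0))
      (chunkDens_nonneg x e)

lemma expect_prob_labelGraph_le {n s : ℕ} {α : Type*} [MeasurableSpace α] {Ω : Type*}
    [MeasurableSpace Ω] (A : StreamAlg n s α Ω) (P : Measure Ω) [IsProbabilityMeasure P]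
    {B : Set α} (hB : MeasurableSet B) {k m : ℕ} (hk : 2 * k ≤ n) (hk0 : 0 < k) {δ : ℝ}
    (hδ0 : 0 < δ) (hδ1 : δ ≤ 1) (hkδ : 2 / (k : ℝ) ≤ δ) (hn : (5 : ℝ) ≤ n)
    (hm : 2 * (n : ℝ) ≤ δ ^ 2 / 16 * m)
    (h : ∀ G : MultiG n, G.m = m → (G.maxCut : ℝ) ≤ (1 / 2 + δ) * m →
      99 / 100 ≤ A.prob P G Bᶜ) :
    𝔼 e : Fin m → Label k, A.prob P (labelGraph hk e) B ≤ 2 / 100 := by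
  have : Nonempty (Fin k) := ⟨⟨0, hk0⟩⟩
  have h1 : ∀ e : Fin m → Label k, A.prob P (labelGraph hk e) B ≤ 1 / 100 +
      if (1 / 2 + δ) * m < ((labelGraph hk e).maxCut : ℝ) then (1 : ℝ) else 0 := by
    intro e
    have h2 := A.prob_add_prob_compl P (labelGraph hk e) hB
    split_ifs with h3
    · linarith [A.prob_nonneg P (labelGraph hk e) Bᶜ]
    · linarith [h (labelGraph hk e) rfl (not_lt.1 h3)]
  refine (Finset.expect_le_expect fun e _ => h1 e).trans ?_
  rw [Finset.expect_add_distrib, Fintype.expect_const]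
  have h3 := expect_maxCut_gt_le hk hk0 m hδ0 hδ1 hkδ
  have h4 := two_pow_mul_exp_neg_le hn hm
  linarith

/-- The common core of both lower bounds: an event that is likely on bipartite multigraphs with `m`
edges and unlikely on those without a cut of much more than half of the edges requires `Ω(√n)` bits
of memory. -/
theorem exists_memory_lower_bound {δ : ℝ} (hδ0 : 0 < δ) (hδ1 : δ ≤ 1) :
    ∃ c : ℝ, 0 < c ∧ ∃ (N : ℕ) (K : ℝ), ∀ n : ℕ, N ≤ n → ∃ m : ℕ, 0 < m ∧ (m : ℝ) ≤ K * n ∧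
      ∀ (s : ℕ) (α : Type) [MeasurableSpace α] (Ω : Type u) [MeasurableSpace Ω] (P : Measure Ω)
        [IsProbabilityMeasure P] (A : StreamAlg n s α Ω) (B : Set α), MeasurableSet B →
        (∀ G : MultiG n, G.m = m → G.IsBipartite → 99 / 100 ≤ A.prob P G B) →
        (∀ G : MultiG n, G.m = m → (G.maxCut : ℝ) ≤ (1 / 2 + δ) * m →
          99 / 100 ≤ A.prob P G Bᶜ) →
        c * √n ≤ s := by
  -- With `R * n` edges the Chernoff bound beats the `2 ^ n` cuts. A chunk has at most `k / D` edges
  -- and contributes `O(1 / D ^ 2)`, so that all `T = O(D * R)` chunks contribute `O(R / D)`.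
  obtain ⟨R, hR⟩ := exists_nat_ge (32 / δ ^ 2)
  have hR0 : (0 : ℝ) < R := lt_of_lt_of_le (by positivity) hR
  have hR1 : (1 : ℝ) ≤ R := by exact_mod_cast (show 0 < R by exact_mod_cast hR0)
  obtain ⟨D, hD⟩ : ∃ D : ℕ, D = 480 * R := ⟨_, rfl⟩
  have hDR : (D : ℝ) = 480 * R := by rw [hD]; push_cast; ring
  have hD480 : (480 : ℝ) ≤ D := by rw [hDR]; linarith
  have hD0 : (0 : ℝ) < D := by linarith
  obtain ⟨T, hT⟩ : ∃ T : ℕ, T = 6 * D * R := ⟨_, rfl⟩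
  have hTR : (T : ℝ) = 6 * D * R := by rw [hT]; push_cast; ring
  have hT0 : (0 : ℝ) < T := by rw [hTR]; positivity
  obtain ⟨a, ha⟩ : ∃ a : ℝ, a = 1 / D := ⟨_, rfl⟩
  have ha0 : 0 < a := by rw [ha]; positivity
  have ha16 : a ≤ 1 / 16 := by
    rw [ha]; exact one_div_le_one_div_of_le (by norm_num) (by linarith)
  obtain ⟨c, hc⟩ : ∃ c : ℝ, c = a ^ 2 / 24 := ⟨_, rfl⟩
  have hc0 : 0 < c := by rw [hc]; positivity
  -- The first summand makes the loss `log (8 * T)` from unlikely memory contents at most `c * √n`.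
  refine ⟨c, hc0, ⌈(8 * T / c) ^ 2⌉₊ + (4 * D + 2) + ⌈6 / δ⌉₊ + 5, 3 * R, fun n hn => ?_⟩
  have hn1 : (8 * T / c) ^ 2 ≤ n := by
    refine (Nat.le_ceil _).trans ?_
    exact_mod_cast (show ⌈(8 * T / c) ^ 2⌉₊ ≤ n by omega)
  have hn2 : 6 / δ ≤ n := by
    refine (Nat.le_ceil _).trans ?_
    exact_mod_cast (show ⌈6 / δ⌉₊ ≤ n by omega)
  obtain ⟨k, hk⟩ : ∃ k, k = n / 2 := ⟨_, rfl⟩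
  have hkn : 2 * k ≤ n := by omega
  have hk0 : 0 < k := by omega
  have hkR : (0 : ℝ) < k := by exact_mod_cast hk0
  have hk3 : (n : ℝ) ≤ 3 * k := by exact_mod_cast (show n ≤ 3 * k by omega)
  have hk2 : 2 * (k : ℝ) ≤ n := by exact_mod_cast hkn
  have hkD : 2 * (D : ℝ) ≤ k := by exact_mod_cast (show 2 * D ≤ k by omega)
  have hnR : (5 : ℝ) ≤ n := by exact_mod_cast (show 5 ≤ n by omega)
  obtain ⟨m, hm⟩ : ∃ m, m = k / D := ⟨_, rfl⟩
  have hmD : (m : ℝ) ≤ k / D := by rw [hm]; exact Nat.cast_div_le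
  have hmD' : (k : ℝ) / D < m + 1 := by
    rw [div_lt_iff₀ hD0]
    have := Nat.lt_div_mul_add (a := k) (b := D) (by exact_mod_cast hD0)
    have h2 : (k : ℝ) < m * D + D := by rw [hm]; exact_mod_cast this
    linarith
  have hm2 : (k : ℝ) / (2 * D) ≤ m := by
    have h1 : (2 : ℝ) ≤ k / D := by rw [le_div_iff₀ hD0]; exact hkD
    have h2 : (k : ℝ) / (2 * D) = k / D / 2 := by field_simp
    linarith
  have hTm : (R : ℝ) * n ≤ (T * m : ℕ) := by
    push_cast
    calc (R : ℝ) * n ≤ R * (3 * k) := by gcongr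
      _ = T * (k / (2 * D)) := by rw [hTR]; field_simp; ring
      _ ≤ T * m := by gcongr
  have hTm' : ((T * m : ℕ) : ℝ) ≤ 3 * R * n := by
    push_cast
    calc (T : ℝ) * m ≤ T * (k / D) := by gcongr
      _ = 3 * R * (2 * k) := by rw [hTR]; field_simp; ring
      _ ≤ 3 * R * n := by gcongr
  have hTm0 : 0 < T * m := by
    have : (0 : ℝ) < (T * m : ℕ) := lt_of_lt_of_le (by positivity) hTm
    exact_mod_cast this
  refine ⟨T * m, hTm0, hTm', ?_⟩
  intro s α _ Ω _ P _ A B hB hyes hno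
  by_contra! hs
  have hsn : 0 < √(n : ℝ) := Real.sqrt_pos.2 (by linarith)
  have hlog : Real.log (2 ^ s / (1 / (8 * T))) ≤ 2 * c * √n := by
    have h3 : 8 * T / c ≤ √n := Real.le_sqrt_of_sq_le hn1
    rw [div_le_iff₀ hc0] at h3
    have := log_two_pow_div_le s hT0
    linarith
  have hsq : √(2 * a / k) ≤ 3 / √n := by
    rw [Real.sqrt_le_left (by positivity), div_pow, Real.sq_sqrt (by linarith),
      div_le_div_iff₀ hkR (by linarith)]
    nlinarith
  have hS : 4 * √(2 * a / k) * Real.log (2 ^ s / (1 / (8 * T))) ≤ a ^ 2 := by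
    calc 4 * √(2 * a / k) * Real.log (2 ^ s / (1 / (8 * T)))
        ≤ 4 * √(2 * a / k) * (2 * c * √n) := by gcongr
      _ ≤ 4 * (3 / √n) * (2 * c * √n) := by gcongr
      _ = a ^ 2 := by rw [hc]; field_simp; norm_num
  have hmain := expect_chunkDens_mul_prob_le A P hB (T := T) hkn hk0 (a := a) (δ := 1 / (8 * T))
    (m := m) (by positivity) (by
      rw [div_le_iff₀ hkR, ha, one_div_mul_eq_div]; exact hmD) ha16 hS
  have herr : T * ((Real.exp (10 * a ^ 2) - 1) + 1 / (8 * T)) ≤ 1 / 2 :=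
    error_le_half hT0 (by nlinarith) (by rw [hTR, ha, hDR]; field_simp; norm_num)
  have hYES := le_expect_chunkDens_mul_prob A P B hkn hk0 (T * m) hyes
  have hδk : 2 / (k : ℝ) ≤ δ := by
    rw [div_le_iff₀ hδ0] at hn2
    rw [div_le_iff₀ hkR]
    linarith only [hn2, mul_le_mul_of_nonneg_left hk3 hδ0.le]
  have hsize : 2 * (n : ℝ) ≤ δ ^ 2 / 16 * (T * m : ℕ) := by
    rw [div_le_iff₀ (by positivity)] at hR
    have h1 := mul_le_mul_of_nonneg_left hTm (sq_nonneg δ)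
    have h2 := mul_le_mul_of_nonneg_right hR (Nat.cast_nonneg (α := ℝ) n)
    linarith only [h1, h2]
  have hNO := expect_prob_labelGraph_le A P hB hkn hk0 hδ0 hδ1 hδk hnR hsize hno
  have he := Real.exp_one_lt_d9
  have he1 := Real.exp_one_gt_d9
  have hfin := mul_le_mul_of_nonneg_left hNO (show 0 ≤ Real.exp 1 - 1 by linarith only [he1])
  linarith only [hmain, hfin, hYES, herr, he]

theorem theorem1 :
    (∀ ε : ℝ, 0 < ε → ε < 2 →
      ∃ c : ℝ, 0 < c ∧ ∃ (b N : ℕ) (K : ℝ),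
        ∀ n : ℕ, N ≤ n → ∀ (s : ℕ) (Ω : Type u) [MeasurableSpace Ω] (P : Measure Ω)
          [IsProbabilityMeasure P] (A : StreamAlg n s ℝ Ω),
          A.ApproximatesMaxCut P (2 - ε) (K * n) →
            c * Real.sqrt n / Real.log n ^ b ≤ s) ∧
    (∀ ε : ℝ, 0 < ε → ε < 1 / 2 →
      ∃ c : ℝ, 0 < c ∧ ∃ (b N : ℕ) (K : ℝ),
        ∀ n : ℕ, N ≤ n → ∀ (s : ℕ) (Ω : Type u) [MeasurableSpace Ω] (P : Measure Ω)
          [IsProbabilityMeasure P] (A : StreamAlg n s Bool Ω),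
          A.DistinguishesBipartite P (1 / 2 - ε) (K * n) →
            c * Real.sqrt n / Real.log n ^ b ≤ s) := by
  constructor
  · intro ε hε0 hε2
    obtain ⟨c, hc, N, K, h⟩ := exists_memory_lower_bound.{u} (δ := ε / 8) (by linarith)
      (by linarith)
    refine ⟨c, hc, 0, N, K, fun n hn s Ω _ P _ A hA => ?_⟩
    obtain ⟨m, hm0, hmK, h⟩ := h n hn
    have hm : (0 : ℝ) < m := by exact_mod_cast hm0
    have hγ : 0 < 2 - ε := by linarith
    rw [pow_zero, div_one]
    refine h s ℝ Ω P A (Set.Ici (m / (2 - ε))) measurableSet_Ici ?_ ?_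
    · rintro G rfl hG
      refine (hA G hmK).trans (A.prob_mono P G ?_)
      rw [hG.maxCut_eq]
      exact Set.Icc_subset_Ici_self
    · rintro G rfl hG
      refine (hA G hmK).trans (A.prob_mono P G ?_)
      intro y hy
      rw [Set.mem_compl_iff, Set.mem_Ici, not_le, lt_div_iff₀ hγ]
      -- `(1 / 2 + ε / 8) * (2 - ε) < 1`
      nlinarith [mul_le_mul_of_nonneg_right (hy.2.trans hG) hγ.le, mul_pos hm hε0,
        mul_pos (mul_pos hm hε0) hε0]
  · intro ε hε0 hε2
    obtain ⟨c, hc, N, K, h⟩ := exists_memory_lower_bound.{u} hε0 (by linarith)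
    refine ⟨c, hc, 0, N, K, fun n hn s Ω _ P _ A hA => ?_⟩
    obtain ⟨m, hm0, hmK, h⟩ := h n hn
    rw [pow_zero, div_one]
    refine h s Bool Ω P A {true} (measurableSet_singleton _) ?_ ?_
    · rintro G rfl hG
      exact (hA G hm0 hmK).1 hG
    · rintro G rfl hG
      refine ((hA G hm0 hmK).2 (MultiG.isFar_of_maxCut_le hG)).trans (A.prob_mono P G ?_)
      simp
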